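/- Let $n\ge 1$, $d=n+1$, $m\ge 0$, $\omega_{\mathbf p}=\sqrt{|\mathbf p|^2+m^2}$, and let $\mathscr H_1=L^2(\mathbb R^n,\frac{d^n\mathbf p}{2\omega_{\mathbf p}};\mathbb C)$ be the one-particle space of the free scalar field of mass $m$. Let $\mathcal F=\bigoplus_{k\ge 0}\mathscr H_1^{\otimes k}$ be the Fock space, with $\mathscr H_1^{\otimes k}=L^2((\mathbb R^n)^k)$ with respect to the product measure, and let $P^\mu$, $\mu=0,\dots,n$, be the momentum operators on $\mathcal F$, acting on the $k$-particle component as multiplication by $\sum_{j=1}^k p_j^\mu$, where $p_j^0=\omega_{\mathbf p_j}$, on the maximal domain. Let $\Delta(P)$ be the space of $f\in\mathscr H_1$ such that $|\mathbf p|^{2r}|f(\mathbf p)|$ is (essentially) bounded for every $r=0,1,2,\dots$, and let $\Delta_k(P)=\Delta(P)^{\otimes k}\subset\mathscr H_1^{\otimes k}$ be the algebraic tensor power. For a unitary operator $V:\mathscr H_1\to\mathscr H_1$ put $\Gamma(V)=\bigoplus_{k\ge 0}V^{\otimes k}$, $X^\mu=\Gamma(V^{-1})P^\mu\Gamma(V)$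 and $\Delta_k(X)=\Gamma(V^{-1})\Delta_k(P)$. Let $(\mathscr K,D)$ be any one of the following pairs of a Hilbert space and a subspace: $(\mathscr H_1^{\otimes k},\Delta_k(X))$ with $k\ge 0$; $(\mathcal F,D_{\mathcal F})$, where $D_{\mathcal F}$ consists of all finite sums of vectors from the $\Delta_k(X)$, $k\ge 0$; or the corresponding bosonic pair, in which $\mathscr K$ is replaced by its subspace of totally symmetric vectors and $D$ by its intersection with that subspace. Then the following holds for the restrictions of the operators $X^\mu$ to $D$, as operators in $\mathscr K$. 1. $D$ is dense in $\mathscr K$ and contained in the domain of every $X^\mu$, $X^\mu D\subset D$, and every $X^\mu$ is essentially self-adjoint on $D$. 2. The components commute: $[X^\mu,X^\nu]\psi=0$ for all $\psi\in D$ and all $\mu,\nu$. 3. For every $p\in\mathbb R^d$ the operator $p\cdot X=\sum_\mu p_\mu X^\mu$ is essentially self-adjoint on $D$. Hence there is a unique unitary operator $U(p)=e^{ip\cdot X}$, the value at time $1$ of the strongly continuous one-parameter unitary group whose generator is the closure of $(p\cdot X)|_D$. Moreover $U(0)=1$ and $U(p+q)=U(p)U(q)$ for all $p,q\in\mathbb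 R^d$, and $p\mapsto U(p)\psi$ is continuous for every $\psi\in\mathscr K$: $U$ is a strongly continuous unitary representation of $\mathbb R^d$. -/

import Mathlib

open MeasureTheory Filter Topology
open scoped ENNReal InnerProductSpace

noncomputable section

namespace WarpedQFT

/-! ### Unbounded operators -/

section Operators

variable {H : Type*} [NormedAddCommGroup H] [InnerProductSpace ℂ H]

/-- A densely defined operator is essentially self-adjoint if it is closable and its closure is
self-adjoint. -/
def IsEssentiallySelfAdjoint [CompleteSpace H] (A : H →ₗ.[ℂ] H) : Prop :=
  Dense (A.domain : Set H) ∧ A.IsClosable ∧ IsSelfAdjoint A.closure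

/-- The operator `W' A W` on its natural domain `{ψ | W ψ ∈ dom A}`. -/
def sandwich (W' : H ≃ₗᵢ[ℂ] H) (A : H →ₗ.[ℂ] H) (W : H ≃ₗᵢ[ℂ] H) : H →ₗ.[ℂ] H where
  domain := A.domain.comap W.toLinearEquiv.toLinearMap
  toFun :=
    { toFun := fun ψ => W' (A ⟨W ψ, ψ.2⟩)
      map_add' := by
        intro x y
        rw [← map_add, ← LinearPMap.map_add]
        congr 2
        ext
        simp
      map_smul' := by
        intro c x
        rw [RingHom.id_apply, ← map_smul, ← LinearPMap.map_smul]
        congr 2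
        ext
        simp }

/-- The part of `A` in the subspace `K`: it acts as `A` on all `ψ ∈ K ∩ dom A` with `A ψ ∈ K`. -/
def part (A : H →ₗ.[ℂ] H) (K : Submodule ℂ H) : K →ₗ.[ℂ] K where
  domain :=
    { carrier := {ψ | ∃ h : (ψ : H) ∈ A.domain, A ⟨ψ, h⟩ ∈ K}
      zero_mem' := ⟨A.domain.zero_mem, by
        have : A ⟨((0 : K) : H), A.domain.zero_mem⟩ = 0 := A.map_zero
        rw [this]; exact K.zero_mem⟩
      add_mem' := by
        rintro x y ⟨hx, hx'⟩ ⟨hy, hy'⟩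
        refine ⟨A.domain.add_mem hx hy, ?_⟩
        have : A ⟨((x + y : K) : H), A.domain.add_mem hx hy⟩ = A ⟨x, hx⟩ + A ⟨y, hy⟩ :=
          A.map_add ⟨x, hx⟩ ⟨y, hy⟩
        rw [this]; exact K.add_mem hx' hy'
      smul_mem' := by
        rintro c x ⟨hx, hx'⟩
        refine ⟨A.domain.smul_mem c hx, ?_⟩
        have : A ⟨((c • x : K) : H), A.domain.smul_mem c hx⟩ = c • A ⟨x, hx⟩ :=
          A.map_smul c ⟨x, hx⟩
        rw [this]; exact K.smul_mem c hx' }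
  toFun :=
    { toFun := fun ψ => ⟨A ⟨ψ.1, ψ.2.1⟩, ψ.2.2⟩
      map_add' := fun x y => Subtype.ext (A.map_add ⟨x.1, x.2.1⟩ ⟨y.1, y.2.1⟩)
      map_smul' := fun c x => Subtype.ext (A.map_smul c ⟨x.1, x.2.1⟩) }

/-- `A` and `B` map `D` into their domains and satisfy `[A, B] ψ = 0` for all `ψ ∈ D`. -/
def CommuteOn (A B : H →ₗ.[ℂ] H) (D : Submodule ℂ H) : Prop :=
  ∀ ψ ∈ D, ∃ (hA : ψ ∈ A.domain) (hB : ψ ∈ B.domain)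
    (hAB : B ⟨ψ, hB⟩ ∈ A.domain) (hBA : A ⟨ψ, hA⟩ ∈ B.domain),
    A ⟨B ⟨ψ, hB⟩, hAB⟩ - B ⟨A ⟨ψ, hA⟩, hBA⟩ = 0

/-- `W = exp (i A)`: the unitary `W` is the value at time `1` of a strongly continuous one-parameter
unitary group whose infinitesimal generator (with its exact domain) is `A`. -/
def IsExpI (A : H →ₗ.[ℂ] H) (W : H ≃ₗᵢ[ℂ] H) : Prop :=
  ∃ T : ℝ → (H ≃ₗᵢ[ℂ] H),
    T 0 = 1 ∧ (∀ s t, T (s + t) = T s * T t) ∧ (∀ ψ, Continuous fun t => T t ψ) ∧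
    (∀ ψ φ : H, (ψ, φ) ∈ A.graph ↔
      Tendsto (fun t : ℝ => ((t : ℂ)⁻¹) • (T t ψ - ψ)) (𝓝[≠] 0) (𝓝 (Complex.I • φ))) ∧
    T 1 = W

/-- The operator `p · X = ∑ μ, p_μ X^μ` with domain `D` (when `D` lies in all the domains). -/
def contraction {d : ℕ} (X : Fin d → (H →ₗ.[ℂ] H)) (D : Submodule ℂ H) (p : Fin d → ℝ) :
    H →ₗ.[ℂ] H :=
  ∑ μ, (p μ : ℂ) • (X μ).domRestrict D

/-- The components `X μ` are essentially self-adjoint on the dense domain `D`, which they leave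
invariant, and they commute there. -/
structure IsCommutingEssSelfAdjoint [CompleteSpace H] {d : ℕ} (X : Fin d → (H →ₗ.[ℂ] H))
    (D : Submodule ℂ H) : Prop where
  dense : Dense (D : Set H)
  le_domain : ∀ μ, D ≤ (X μ).domain
  essSelfAdjoint : ∀ μ, IsEssentiallySelfAdjoint ((X μ).domRestrict D)
  mapsTo : ∀ μ (ψ : (X μ).domain), (ψ : H) ∈ D → X μ ψ ∈ D
  commute : ∀ μ ν, CommuteOn (X μ) (X ν) D

/-- Every `p · X` is essentially self-adjoint on `D`, so that its closure has a well-defined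
exponential `U p = exp (i p · X)`, and `U` is a strongly continuous unitary representation of the
additive group `ℝ^d`. -/
def GeneratesUnitaryGroup [CompleteSpace H] {d : ℕ} (X : Fin d → (H →ₗ.[ℂ] H))
    (D : Submodule ℂ H) : Prop :=
  (∀ p : Fin d → ℝ, IsEssentiallySelfAdjoint (contraction X D p)) ∧
  ∃ U : (Fin d → ℝ) → (H ≃ₗᵢ[ℂ] H),
    (∀ p, IsExpI (contraction X D p).closure (U p) ∧
      ∀ W, IsExpI (contraction X D p).closure W → W = U p) ∧
    U 0 = 1 ∧ (∀ p q, U (p + q) = U p * U q) ∧ ∀ ψ, Continuous fun p => U p ψ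

end Operators

/-! ### Hilbert direct sums -/

section DirectSum

variable {E : ℕ → Type*} [∀ k, NormedAddCommGroup (E k)] [∀ k, InnerProductSpace ℂ (E k)]

lemma memlp_map (W : ∀ k, E k ≃ₗᵢ[ℂ] E k) (ψ : lp E 2) : Memℓp (fun k => W k (ψ k)) 2 := by
  have h := lp.memℓp ψ
  rw [memℓp_gen_iff (by norm_num)] at h ⊢
  simpa using h

/-- The direct sum `⨁ k, W k` of unitary operators. -/
def directSumUnitary (W : ∀ k, E k ≃ₗᵢ[ℂ] E k) : lp E 2 ≃ₗᵢ[ℂ] lp E 2 where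
  toFun := fun ψ => ⟨fun k => W k (ψ k), memlp_map W ψ⟩
  invFun := fun ψ => ⟨fun k => (W k).symm (ψ k), memlp_map (fun k => (W k).symm) ψ⟩
  left_inv := fun ψ => by ext k; simp
  right_inv := fun ψ => by ext k; simp
  map_add' := fun x y => by ext k; exact map_add (W k) (x k) (y k)
  map_smul' := fun c x => by ext k; simp
  norm_map' := fun ψ => by
    simp [lp.norm_eq_tsum_rpow (p := 2) (by norm_num)]

/-- The direct sum `⨁ k, A k` of operators, on its maximal domain. -/
def directSumOp (A : ∀ k, E k →ₗ.[ℂ] E k) : lp E 2 →ₗ.[ℂ] lp E 2 where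
  domain :=
    { carrier := {ψ | ∃ h : ∀ k, ψ k ∈ (A k).domain, Memℓp (fun k => A k ⟨ψ k, h k⟩) 2}
      zero_mem' := ⟨fun k => (A k).domain.zero_mem, by
        have : (fun k => A k ⟨(0 : lp E 2) k, (A k).domain.zero_mem⟩) = 0 := by
          ext k; exact (A k).map_zero
        rw [this]; exact zero_memℓp⟩
      add_mem' := by
        rintro x y ⟨hx, hx'⟩ ⟨hy, hy'⟩
        refine ⟨fun k => (A k).domain.add_mem (hx k) (hy k), ?_⟩
        have : (fun k => A k ⟨(x + y) k, (A k).domain.add_mem (hx k) (hy k)⟩) =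
            (fun k => A k ⟨x k, hx k⟩) + fun k => A k ⟨y k, hy k⟩ := by
          ext k; exact (A k).map_add ⟨x k, hx k⟩ ⟨y k, hy k⟩
        rw [this]; exact hx'.add hy'
      smul_mem' := by
        rintro c x ⟨hx, hx'⟩
        refine ⟨fun k => (A k).domain.smul_mem c (hx k), ?_⟩
        have : (fun k => A k ⟨(c • x) k, (A k).domain.smul_mem c (hx k)⟩) =
            c • fun k => A k ⟨x k, hx k⟩ := by
          ext k; exact (A k).map_smul c ⟨x k, hx k⟩
        rw [this]; exact hx'.const_smul c }
  toFun :=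
    { toFun := fun ψ => ⟨fun k => A k ⟨ψ.1 k, ψ.2.1 k⟩, ψ.2.2⟩
      map_add' := fun x y => by
        ext k; exact (A k).map_add ⟨x.1 k, x.2.1 k⟩ ⟨y.1 k, y.2.1 k⟩
      map_smul' := fun c x => by
        ext k; exact (A k).map_smul c ⟨x.1 k, x.2.1 k⟩ }

/-- Vectors with finitely many nonzero components, the `k`-th one in `D k`. -/
def finiteSum (D : ∀ k, Submodule ℂ (E k)) : Submodule ℂ (lp E 2) where
  carrier := {ψ | (∀ k, ψ k ∈ D k) ∧ {k | ψ k ≠ 0}.Finite}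
  zero_mem' := ⟨fun k => (D k).zero_mem, by simp⟩
  add_mem' := by
    rintro x y ⟨hx, hx'⟩ ⟨hy, hy'⟩
    refine ⟨fun k => (D k).add_mem (hx k) (hy k), (hx'.union hy').subset ?_⟩
    intro k hk
    by_contra h
    simp only [Set.mem_union, Set.mem_ofPred_eq, not_or, not_not] at h
    exact hk (by simp [h.1, h.2])
  smul_mem' := by
    rintro c x ⟨hx, hx'⟩
    refine ⟨fun k => (D k).smul_mem c (hx k), hx'.subset ?_⟩
    intro k hk h
    exact hk (by simp [h])

/-- Vectors whose `k`-th component lies in `K k` for every `k`. -/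
def componentwise (K : ∀ k, Submodule ℂ (E k)) : Submodule ℂ (lp E 2) :=
  ⨅ k, (K k).comap (lp.evalₗ E 2 k (𝕜 := ℂ))

instance (K : ∀ k, Submodule ℂ (E k)) [∀ k, CompleteSpace (E k)] [∀ k, CompleteSpace (K k)] :
    CompleteSpace (componentwise K) := by
  have : IsClosed (componentwise K : Set (lp E 2)) := by
    have h : (componentwise K : Set (lp E 2)) =
        ⋂ k, (fun ψ => lp.evalCLM ℂ E 2 k ψ) ⁻¹' (K k : Set (E k)) := by
      ext ψ; simp [componentwise]; rfl
    rw [h]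
    refine isClosed_iInter fun k => IsClosed.preimage (lp.evalCLM ℂ E 2 k).continuous ?_
    exact (completeSpace_coe_iff_isComplete.1 inferInstance).isClosed
  exact this.completeSpace_coe

end DirectSum

/-! ### Tensor powers of `L²` -/

section Tensor

variable {α : Type*} [MeasurableSpace α]

/-- Multiplication by the real function `a` on its maximal domain in `L²(ν)`. -/
def mulOp (ν : Measure α) (a : α → ℝ) : Lp ℂ 2 ν →ₗ.[ℂ] Lp ℂ 2 ν where
  domain :=
    { carrier := {f | MemLp (fun x => (a x : ℂ) * f x) 2 ν}
      zero_mem' := by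
        refine (MemLp.zero (ε := ℂ)).ae_eq ?_
        filter_upwards [Lp.coeFn_zero ℂ 2 ν] with x hx
        rw [hx]; simp
      add_mem' := by
        intro f g hf hg
        refine (MemLp.add hf hg).ae_eq ?_
        filter_upwards [Lp.coeFn_add f g] with x hx
        rw [hx]; simp only [Pi.add_apply]; ring
      smul_mem' := by
        intro c f hf
        refine (MemLp.const_smul hf c).ae_eq ?_
        filter_upwards [Lp.coeFn_smul c f] with x hx
        simp [hx, mul_left_comm] }
  toFun :=
    { toFun := fun f => MemLp.toLp _ f.2
      map_add' := by
        intro f g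
        rw [← MemLp.toLp_add]
        refine MemLp.toLp_congr _ _ ?_
        filter_upwards [Lp.coeFn_add f.1 g.1] with x hx
        simp only [Submodule.coe_add, Pi.add_apply]; rw [hx, Pi.add_apply]; ring
      map_smul' := by
        intro c f
        rw [RingHom.id_apply, ← MemLp.toLp_const_smul]
        refine MemLp.toLp_congr _ _ ?_
        filter_upwards [Lp.coeFn_smul c f.1] with x hx
        simp [hx, mul_left_comm] }

variable (ν : Measure α) [SigmaFinite ν]

/-- The `k`-fold Hilbert space tensor power of `L²(α, ν)`, realized as `L²(α^k, ν^k)`. -/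
abbrev TensorPow (k : ℕ) : Type _ := Lp ℂ 2 (Measure.pi fun _ : Fin k => ν)

variable {ν} {k : ℕ}

lemma memLp_prod (f : Fin k → Lp ℂ 2 ν) :
    MemLp (fun x : Fin k → α => ∏ i, f i (x i)) 2 (Measure.pi fun _ : Fin k => ν) := by
  rw [memLp_two_iff_integrable_sq_norm]
  · have h := Integrable.fintype_prod (μ := fun _ : Fin k => ν)
      (f := fun i x => ‖f i x‖ ^ 2) (fun i => (Lp.memLp (f i)).integrable_norm_pow (by norm_num))
    simpa [Finset.prod_pow] using h
  · refine Finset.aestronglyMeasurable_fun_prod _ fun i _ => ?_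
    exact (Lp.aestronglyMeasurable (f i)).comp_quasiMeasurePreserving
      (Measure.quasiMeasurePreserving_eval _ i)

/-- The elementary tensor `f₁ ⊗ ⋯ ⊗ f_k`, that is `(x₁, …, x_k) ↦ f₁ x₁ ⋯ f_k x_k`. -/
def tensor (f : Fin k → Lp ℂ 2 ν) : TensorPow ν k := (memLp_prod f).toLp _

/-- On elementary tensors, multiplication by `a x₁ + ⋯ + a x_k` is the second quantization
`∑ j, 1 ⊗ ⋯ ⊗ a ⊗ ⋯ ⊗ 1` of multiplication by `a`. -/
lemma mulOp_sum_tensor (a : α → ℝ) (f : Fin k → (mulOp ν a).domain) :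
    (tensor fun i => (f i : Lp ℂ 2 ν),
      ∑ j, tensor (Function.update (fun i => (f i : Lp ℂ 2 ν)) j (mulOp ν a (f j)))) ∈
      (mulOp (Measure.pi fun _ : Fin k => ν) fun x => ∑ j, a (x j)).graph := by
  set g : Fin k → Lp ℂ 2 ν := fun i => (f i : Lp ℂ 2 ν) with hg
  have h1 : ∀ᵐ x ∂(Measure.pi fun _ : Fin k => ν), ∀ j,
      (mulOp ν a (f j) : Lp ℂ 2 ν) (x j) = a (x j) * g j (x j) :=
    ae_all_iff.2 fun j => (Measure.quasiMeasurePreserving_eval (fun _ : Fin k => ν) j).ae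
      (MemLp.coeFn_toLp (f j).2)
  have h2 : ∀ᵐ x ∂(Measure.pi fun _ : Fin k => ν), ∀ j,
      tensor (Function.update g j (mulOp ν a (f j))) x =
        ∏ i, Function.update g j (mulOp ν a (f j)) i (x i) :=
    ae_all_iff.2 fun j => MemLp.coeFn_toLp (memLp_prod _)
  have key : ((∑ j, tensor (Function.update g j (mulOp ν a (f j))) : TensorPow ν k) :
      (Fin k → α) → ℂ) =ᵐ[Measure.pi fun _ : Fin k => ν]
      fun x => ((∑ j, a (x j) : ℝ) : ℂ) * tensor g x := by
    filter_upwards [h1, h2, MemLp.coeFn_toLp (memLp_prod g),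
      Lp.coeFn_finsetSum (s := Finset.univ)
        fun j => tensor (Function.update g j (mulOp ν a (f j)))] with x h1 h2 h3 h4
    rw [h4, Finset.sum_apply, tensor, h3, Complex.ofReal_sum, Finset.sum_mul]
    refine Finset.sum_congr rfl fun j _ => ?_
    rw [h2, ← Finset.mul_prod_erase _ _ (Finset.mem_univ j),
      ← Finset.mul_prod_erase Finset.univ (fun i => g i (x i)) (Finset.mem_univ j),
      Function.update_self, h1, mul_assoc]
    congr 2
    refine Finset.prod_congr rfl fun i hi => ?_
    rw [Function.update_of_ne (Finset.ne_of_mem_erase hi)]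
  have hmem := (Lp.memLp (∑ j, tensor (Function.update g j (mulOp ν a (f j))))).ae_eq key
  refine (LinearPMap.mem_graph_iff _).2 ⟨⟨tensor g, hmem⟩, rfl, ?_⟩
  refine Lp.ext ((MemLp.coeFn_toLp hmem).trans key.symm)

lemma inner_tensor (f g : Fin k → Lp ℂ 2 ν) :
    ⟪tensor f, tensor g⟫_ℂ = ∏ i, ⟪f i, g i⟫_ℂ := by
  rw [L2.inner_def]
  simp_rw [L2.inner_def]
  rw [← integral_fintype_prod_eq_prod (𝕜 := ℂ) (μ := fun _ : Fin k => ν)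
    (f := fun i x => ⟪f i x, g i x⟫_ℂ)]
  refine integral_congr_ae ?_
  filter_upwards [MemLp.coeFn_toLp (memLp_prod f), MemLp.coeFn_toLp (memLp_prod g)] with x hf hg
  rw [tensor, tensor, hf, hg]
  simp [RCLike.inner_apply, Finset.prod_mul_distrib]

lemma setIntegral_box_eq_zero {h : TensorPow ν k} (hh : ∀ f, ⟪tensor f, h⟫_ℂ = 0)
    (s : Fin k → Set α) (hs : ∀ i, MeasurableSet (s i)) (hν : ∀ i, ν (s i) ≠ ∞) :
    ∫ x in Set.univ.pi s, h x ∂(Measure.pi fun _ : Fin k => ν) = 0 := by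
  have hpi : MeasurableSet (Set.univ.pi s) := MeasurableSet.univ_pi hs
  have hfin : (Measure.pi fun _ : Fin k => ν) (Set.univ.pi s) ≠ ∞ := by
    rw [Measure.pi_pi]
    exact ENNReal.prod_ne_top fun i _ => hν i
  rw [← L2.inner_indicatorConstLp_one hpi hfin h, ← hh fun i => indicatorConstLp 2 (hs i) (hν i) 1]
  congr 1
  refine Lp.ext ?_
  have h1 : ∀ᵐ x ∂(Measure.pi fun _ : Fin k => ν), ∀ i,
      indicatorConstLp 2 (hs i) (hν i) (1 : ℂ) (x i) = (s i).indicator (fun _ => 1) (x i) :=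
    ae_all_iff.2 fun i => (Measure.quasiMeasurePreserving_eval (fun _ : Fin k => ν) i).ae
      (indicatorConstLp_coeFn (p := 2) (hs := hs i) (hμs := hν i) (c := (1 : ℂ)))
  filter_upwards [indicatorConstLp_coeFn (p := 2) (hs := hpi) (hμs := hfin) (c := (1 : ℂ)),
    MemLp.coeFn_toLp (memLp_prod fun i => indicatorConstLp 2 (hs i) (hν i) (1 : ℂ)), h1]
    with x hx hx' hx1
  rw [hx, tensor, hx']
  simp_rw [hx1]
  by_cases hxs : x ∈ Set.univ.pi s
  · rw [Set.indicator_of_mem hxs]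
    refine (Finset.prod_eq_one fun i _ => ?_).symm
    rw [Set.indicator_of_mem (hxs i (Set.mem_univ i))]
  · rw [Set.indicator_of_notMem hxs]
    simp only [Set.mem_pi, Set.mem_univ, true_implies, not_forall] at hxs
    obtain ⟨i, hi⟩ := hxs
    refine (Finset.prod_eq_zero (Finset.mem_univ i) ?_).symm
    rw [Set.indicator_of_notMem hi]

lemma eq_zero_of_inner_tensor {h : TensorPow ν k} (hh : ∀ f, ⟪tensor f, h⟫_ℂ = 0) : h = 0 := by
  set π : Measure (Fin k → α) := Measure.pi fun _ : Fin k => ν with hπ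
  have key : ∀ N : ℕ, ∀ t, MeasurableSet t →
      ∫ x in t ∩ Set.univ.pi (fun _ : Fin k => spanningSets ν N), h x ∂π = 0 := by
    intro N
    set B : Set (Fin k → α) := Set.univ.pi fun _ : Fin k => spanningSets ν N with hB
    have hBm : MeasurableSet B := MeasurableSet.univ_pi fun _ => measurableSet_spanningSets ν N
    have hBf : π B ≠ ∞ := by
      rw [hπ, hB, Measure.pi_pi]
      exact ENNReal.prod_ne_top fun i _ => (measure_spanningSets_lt_top ν N).ne
    have hint : IntegrableOn h B π := by
      have : Fact (π B < ∞) := ⟨hBf.lt_top⟩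
      exact (((Lp.memLp h).restrict B).mono_exponent (by norm_num)).integrable le_rfl
    have hB0 : ∫ x in B, h x ∂π = 0 :=
      setIntegral_box_eq_zero hh _ (fun _ => measurableSet_spanningSets ν N)
        fun _ => (measure_spanningSets_lt_top ν N).ne
    intro t ht
    induction t, ht using MeasurableSpace.induction_on_inter
      (generateFrom_pi (α := fun _ : Fin k => α)).symm isPiSystem_pi with
    | empty => simp
    | basic t ht =>
      obtain ⟨s, hs, rfl⟩ := ht
      rw [hB, ← Set.pi_inter_distrib]
      refine setIntegral_box_eq_zero hh _
        (fun i => (hs i (Set.mem_univ i)).inter (measurableSet_spanningSets ν N)) fun i => ?_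
      exact ((measure_mono Set.inter_subset_right).trans_lt (measure_spanningSets_lt_top ν N)).ne
    | compl t ht ih =>
      have h1 := setIntegral_union (μ := π) (f := h) (s := t ∩ B) (t := tᶜ ∩ B)
        (Set.disjoint_left.2 fun x hx hx' => hx'.1 hx.1) (ht.compl.inter hBm)
        (hint.mono_set Set.inter_subset_right) (hint.mono_set Set.inter_subset_right)
      rw [← Set.union_inter_distrib_right, Set.union_compl_self, Set.univ_inter, hB0, ih,
        zero_add] at h1
      exact h1.symm
    | iUnion t hd ht ih =>
      rw [Set.iUnion_inter, integral_iUnion (fun i => (ht i).inter hBm)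
        (fun i j hij => (hd hij).mono Set.inter_subset_left Set.inter_subset_left)
        (hint.mono_set (Set.iUnion_subset fun i => Set.inter_subset_right))]
      simp [ih]
  have hae : ∀ N : ℕ, ∀ᵐ x ∂π,
      x ∈ Set.univ.pi (fun _ : Fin k => spanningSets ν N) → h x = 0 := by
    intro N
    set B : Set (Fin k → α) := Set.univ.pi fun _ : Fin k => spanningSets ν N with hB
    have hBm : MeasurableSet B := MeasurableSet.univ_pi fun _ => measurableSet_spanningSets ν N
    have hBf : π B ≠ ∞ := by
      rw [hπ, hB, Measure.pi_pi]
      exact ENNReal.prod_ne_top fun i _ => (measure_spanningSets_lt_top ν N).ne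
    have hint : IntegrableOn h B π := by
      have : Fact (π B < ∞) := ⟨hBf.lt_top⟩
      exact (((Lp.memLp h).restrict B).mono_exponent (by norm_num)).integrable le_rfl
    refine (ae_restrict_iff' hBm).1 ?_
    refine Integrable.ae_eq_zero_of_forall_setIntegral_eq_zero hint fun t ht _ => ?_
    rw [Measure.restrict_restrict ht]
    exact key N t ht
  refine Lp.ext ?_
  filter_upwards [ae_all_iff.2 hae, Lp.coeFn_zero ℂ 2 π] with x hx hx0
  rw [hx0]
  have hmem : ∀ i : Fin k, ∃ N, x i ∈ spanningSets ν N := fun i =>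
    ⟨_, mem_spanningSetsIndex ν (x i)⟩
  choose N hN using hmem
  refine hx (Finset.univ.sup N) fun i _ => ?_
  exact monotone_spanningSets ν (Finset.le_sup (Finset.mem_univ i)) (hN i)

lemma norm_linearCombination_eq {ι E : Type*} [NormedAddCommGroup E] [InnerProductSpace ℂ E]
    {u v : ι → E} (h : ∀ i j, ⟪u i, u j⟫_ℂ = ⟪v i, v j⟫_ℂ) (c : ι →₀ ℂ) :
    ‖Finsupp.linearCombination ℂ u c‖ = ‖Finsupp.linearCombination ℂ v c‖ := by
  have : ⟪Finsupp.linearCombination ℂ u c, Finsupp.linearCombination ℂ u c⟫_ℂ =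
      ⟪Finsupp.linearCombination ℂ v c, Finsupp.linearCombination ℂ v c⟫_ℂ := by
    simp only [Finsupp.linearCombination_apply, Finsupp.sum_inner, Finsupp.inner_sum, inner_smul_left,
      inner_smul_right, h]
  rw [@norm_eq_sqrt_re_inner ℂ, @norm_eq_sqrt_re_inner ℂ, this]

lemma denseRange_tensor :
    DenseRange (Finsupp.linearCombination ℂ (tensor : (Fin k → Lp ℂ 2 ν) → TensorPow ν k)) := by
  have h : (LinearMap.range (Finsupp.linearCombination ℂ
      (tensor : (Fin k → Lp ℂ 2 ν) → TensorPow ν k))).topologicalClosure = ⊤ := by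
    rw [Submodule.topologicalClosure_eq_top_iff, Submodule.eq_bot_iff]
    intro x hx
    refine eq_zero_of_inner_tensor fun f => ?_
    refine (Submodule.mem_orthogonal _ _).1 hx _ ⟨Finsupp.single f 1, by simp⟩
  exact Submodule.dense_iff_topologicalClosure_eq_top.2 h

/-- `V^{⊗k}` as a bounded operator: the continuous linear extension of
`f₁ ⊗ ⋯ ⊗ f_k ↦ V f₁ ⊗ ⋯ ⊗ V f_k`. -/
def tensorPowCLM (V : Lp ℂ 2 ν ≃ₗᵢ[ℂ] Lp ℂ 2 ν) (k : ℕ) : TensorPow ν k →L[ℂ] TensorPow ν k :=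
  (Finsupp.linearCombination ℂ fun f : Fin k → Lp ℂ 2 ν => tensor fun i => V (f i)).extendOfNorm
    (Finsupp.linearCombination ℂ tensor)

lemma tensorPowCLM_linearCombination (V : Lp ℂ 2 ν ≃ₗᵢ[ℂ] Lp ℂ 2 ν)
    (c : (Fin k → Lp ℂ 2 ν) →₀ ℂ) :
    tensorPowCLM V k (Finsupp.linearCombination ℂ tensor c) =
      Finsupp.linearCombination ℂ (fun f : Fin k → Lp ℂ 2 ν => tensor fun i => V (f i)) c := by
  refine LinearMap.extendOfNorm_eq denseRange_tensor ⟨1, fun x => ?_⟩ c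
  rw [one_mul]
  exact (norm_linearCombination_eq (fun f g => by simp [inner_tensor]) x).le

lemma tensorPowCLM_tensor (V : Lp ℂ 2 ν ≃ₗᵢ[ℂ] Lp ℂ 2 ν) (f : Fin k → Lp ℂ 2 ν) :
    tensorPowCLM V k (tensor f) = tensor fun i => V (f i) := by
  simpa using tensorPowCLM_linearCombination V (Finsupp.single f 1)

lemma tensorPowCLM_comp (V W : Lp ℂ 2 ν ≃ₗᵢ[ℂ] Lp ℂ 2 ν) (h : ∀ f, V (W f) = f)
    (ψ : TensorPow ν k) : tensorPowCLM V k (tensorPowCLM W k ψ) = ψ := by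
  refine denseRange_tensor.induction_on ψ (isClosed_eq (by fun_prop) continuous_id) fun c => ?_
  induction c using Finsupp.induction_linear with
  | zero => simp
  | add c d hc hd => rw [map_add, map_add, map_add, hc, hd]
  | single f a => simp [tensorPowCLM_tensor, h]

lemma norm_tensorPowCLM (V : Lp ℂ 2 ν ≃ₗᵢ[ℂ] Lp ℂ 2 ν) (ψ : TensorPow ν k) :
    ‖tensorPowCLM V k ψ‖ = ‖ψ‖ := by
  refine denseRange_tensor.induction_on ψ (isClosed_eq (by fun_prop) continuous_norm) fun c => ?_
  rw [tensorPowCLM_linearCombination]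
  exact norm_linearCombination_eq (fun f g => by simp [inner_tensor]) c

/-- The tensor power `V^{⊗k}` of a unitary operator `V`. -/
def tensorPow (V : Lp ℂ 2 ν ≃ₗᵢ[ℂ] Lp ℂ 2 ν) (k : ℕ) : TensorPow ν k ≃ₗᵢ[ℂ] TensorPow ν k where
  toFun := tensorPowCLM V k
  invFun := tensorPowCLM V.symm k
  left_inv := tensorPowCLM_comp _ _ fun f => V.symm_apply_apply f
  right_inv := tensorPowCLM_comp _ _ fun f => V.apply_symm_apply f
  map_add' := map_add _
  map_smul' := map_smul _
  norm_map' := norm_tensorPowCLM V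

lemma tensorPow_tensor (V : Lp ℂ 2 ν ≃ₗᵢ[ℂ] Lp ℂ 2 ν) (f : Fin k → Lp ℂ 2 ν) :
    tensorPow V k (tensor f) = tensor fun i => V (f i) := tensorPowCLM_tensor V f

lemma measurePreserving_perm (σ : Equiv.Perm (Fin k)) :
    MeasurePreserving (fun x : Fin k → α => x ∘ σ) (Measure.pi fun _ => ν)
      (Measure.pi fun _ => ν) :=
  by
  convert! measurePreserving_piCongrLeft (fun _ : Fin k => ν) σ.symm using 1
  ext x i
  have := MeasurableEquiv.piCongrLeft_apply_apply (β := fun _ : Fin k => α) σ.symm x (σ i)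
  simpa using this.symm

variable (ν k) in
/-- The bosonic (totally symmetric) `k`-particle subspace. -/
def symmetricSubspace : Submodule ℂ (TensorPow ν k) :=
  ⨅ σ : Equiv.Perm (Fin k), LinearMap.ker
    ((Lp.compMeasurePreservingₗᵢ ℂ (E := ℂ) (p := 2) _
      (measurePreserving_perm (ν := ν) σ)).toLinearMap - LinearMap.id)

instance : CompleteSpace (symmetricSubspace ν k) := by
  have : IsClosed (symmetricSubspace ν k : Set (TensorPow ν k)) := by
    rw [symmetricSubspace, Submodule.coe_iInf]
    refine isClosed_iInter fun σ => ?_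
    exact ((Lp.compMeasurePreservingₗᵢ ℂ (E := ℂ) (p := 2) _
      (measurePreserving_perm (ν := ν) σ)).toContinuousLinearMap -
        ContinuousLinearMap.id ℂ _).isClosed_ker
  exact this.completeSpace_coe

end Tensor

/-! ### The free scalar field -/

/-- The relativistic energy `ω_p = √(|p|² + m²)`. -/
def energy {n : ℕ} (m : ℝ) (p : EuclideanSpace ℝ (Fin n)) : ℝ := √(‖p‖ ^ 2 + m ^ 2)

/-- The point `(ω_p, p)` of the mass shell `H_m^+ ⊆ ℝ^{n+1}`. -/
def fourMomentum {n : ℕ} (m : ℝ) (p : EuclideanSpace ℝ (Fin n)) : Fin (n + 1) → ℝ :=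
  Fin.cons (energy m p) fun j => p j

/-- The invariant measure `d^n p / (2 ω_p)`. -/
def shellMeasure (n : ℕ) (m : ℝ) : Measure (EuclideanSpace ℝ (Fin n)) :=
  volume.withDensity fun p => ENNReal.ofReal ((2 * energy m p)⁻¹)

instance (n : ℕ) (m : ℝ) : SigmaFinite (shellMeasure n m) :=
  SigmaFinite.withDensity_ofReal _

/-- The one-particle Hilbert space. -/
abbrev OneParticle (n : ℕ) (m : ℝ) : Type := Lp ℂ 2 (shellMeasure n m)

/-- The `k`-particle space `ℋ₁^{⊗k}`, before symmetrization. -/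
abbrev KParticle (n : ℕ) (m : ℝ) (k : ℕ) : Type := TensorPow (shellMeasure n m) k

/-- The (full) Fock space `⨁ k, ℋ₁^{⊗k}`. -/
abbrev Fock (n : ℕ) (m : ℝ) : Type := lp (fun k => KParticle n m k) 2

/-- The bosonic Fock space, a closed subspace of the full one. -/
abbrev bosonicFock (n : ℕ) (m : ℝ) : Submodule ℂ (Fock n m) :=
  componentwise fun k => symmetricSubspace (shellMeasure n m) k

/-- The momentum operator `P^μ` on the `k`-particle space: multiplication by the total momentum
`p₁^μ + ⋯ + p_k^μ`, that is `∑ j, 1 ⊗ ⋯ ⊗ P^μ ⊗ ⋯ ⊗ 1`. -/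
def momentumK (n : ℕ) (m : ℝ) (k : ℕ) (μ : Fin (n + 1)) : KParticle n m k →ₗ.[ℂ] KParticle n m k :=
  mulOp _ fun x => ∑ j, fourMomentum m (x j) μ

/-- The second quantized momentum operator `P^μ` on Fock space, on its maximal domain (the operator
with lower index is `P_μ = ± P^μ`). -/
def momentum (n : ℕ) (m : ℝ) (μ : Fin (n + 1)) : Fock n m →ₗ.[ℂ] Fock n m :=
  directSumOp fun k => momentumK n m k μ

/-- The second quantization `Γ(V) = ⨁ k, V^{⊗k}`. -/
def Gam {n : ℕ} {m : ℝ} (V : OneParticle n m ≃ₗᵢ[ℂ] OneParticle n m) : Fock n m ≃ₗᵢ[ℂ] Fock n m :=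
  directSumUnitary fun k => tensorPow V k

/-- `Δ(P)`: the `f ∈ ℋ₁` such that `|p|^{2r} |f(p)|` is (essentially) bounded for all `r ∈ ℕ`. -/
def deltaP (n : ℕ) (m : ℝ) : Submodule ℂ (OneParticle n m) where
  carrier := {f | ∀ r : ℕ, ∃ c : ℝ, ∀ᵐ p ∂(shellMeasure n m), ‖(((‖p‖ ^ 2) ^ r : ℝ) : ℂ) * f p‖ ≤ c}
  zero_mem' := fun r => ⟨0, by
    filter_upwards [Lp.coeFn_zero ℂ 2 (shellMeasure n m)] with p hp
    rw [hp]; simp⟩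
  add_mem' := by
    intro f g hf hg r
    obtain ⟨c, hc⟩ := hf r
    obtain ⟨d, hd⟩ := hg r
    refine ⟨c + d, ?_⟩
    filter_upwards [hc, hd, Lp.coeFn_add f g] with p h1 h2 h3
    rw [h3, Pi.add_apply, mul_add]
    exact (norm_add_le _ _).trans (add_le_add h1 h2)
  smul_mem' := by
    intro a f hf r
    obtain ⟨c, hc⟩ := hf r
    refine ⟨‖a‖ * c, ?_⟩
    filter_upwards [hc, Lp.coeFn_smul a f] with p h1 h2
    rw [h2, Pi.smul_apply, smul_eq_mul, mul_left_comm, norm_mul]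
    exact mul_le_mul_of_nonneg_left h1 (norm_nonneg a)

/-- `Δ_k(P)`, the algebraic `k`-fold tensor power of `Δ(P)`. -/
def deltaKP (n : ℕ) (m : ℝ) (k : ℕ) : Submodule ℂ (KParticle n m k) :=
  Submodule.span ℂ {ψ | ∃ f : Fin k → OneParticle n m, (∀ i, f i ∈ deltaP n m) ∧ ψ = tensor f}

/-- The domain on Fock space given by all the `Δ_k(P)`: finite sums of vectors in them. -/
def deltaFockP (n : ℕ) (m : ℝ) : Submodule ℂ (Fock n m) := finiteSum fun k => deltaKP n m k

section X

variable {n : ℕ} {m : ℝ} (V : OneParticle n m ≃ₗᵢ[ℂ] OneParticle n m)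

/-- The operator `X^μ = Γ(V⁻¹) P^μ Γ(V)` on Fock space. -/
def opX (μ : Fin (n + 1)) : Fock n m →ₗ.[ℂ] Fock n m :=
  sandwich (Gam V.symm) (momentum n m μ) (Gam V)

/-- The domain `Γ(V⁻¹) ⨁ k, Δ_k(P)` on Fock space. -/
def deltaFockX : Submodule ℂ (Fock n m) :=
  (deltaFockP n m).map (Gam V.symm).toLinearEquiv.toLinearMap

/-- The restriction of `X^μ` to the `k`-particle space. -/
def opXK (k : ℕ) (μ : Fin (n + 1)) : KParticle n m k →ₗ.[ℂ] KParticle n m k :=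
  sandwich (tensorPow V.symm k) (momentumK n m k μ) (tensorPow V k)

/-- The domain `Δ_k(X) = Γ(V⁻¹) Δ_k(P)` in the `k`-particle space. -/
def deltaKX (k : ℕ) : Submodule ℂ (KParticle n m k) :=
  (deltaKP n m k).map (tensorPow V.symm k).toLinearEquiv.toLinearMap

end X

end WarpedQFT

end

open WarpedQFT

noncomputable section

namespace WarpedQFT

/-! ### Unitary groups and essential self-adjointness -/

section OneParameter

variable {H : Type*} [NormedAddCommGroup H] [InnerProductSpace ℂ H]

/-! The representation can be written down: on the `k`-particle space, `translationK` multiplies by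
the phase `exp (i ∑ p_μ (p₁^μ + ⋯ + p_k^μ))`, and `expK`, `expFock` are its conjugates by `V^{⊗k}`
and `Γ(V)`. What needs proof is that the small domain `D` already determines its generators.

The tool is Nelson's invariant domain criterion: a dense subspace that is invariant under a unitary
group `T` and consists of differentiable vectors is a core for the generator. If `⟪x, A ψ⟫ = c i ⟪x,
ψ⟫` on `D` with `c` real and nonzero, then `⟪x, T t ψ⟫ = e^{-ct} ⟪x, ψ⟫`; this is bounded in `t`,
hence zero (`IsInvariantCore.eq_zero_of_inner`). Essential self-adjointness follows, the closure is
the generator of `T` (`mem_graph_closure_iff`), and the exponential is unique (`isExpI_unique`).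
Vanishing commutators come from differentiating `U p * U q = U q * U p` (`Integrates.commuteOn`).

The predicate `Integrates` collects what these arguments need. It is stable under unitary
conjugation, restriction to closed invariant subspaces and direct sums, so only the momentum
operators on `k` particles remain (`integrates_momentumK`). There, phases preserve `Δ(P)` because
only `|f|` enters its definition, and multiplication by `p^μ` preserves it because `|p^μ| ≤ |𝐩| +
|m|`; both facts pass to tensors because the total momentum is a sum over particles. In the bosonic
case the representation and the domain are compatible with permutations, and symmetrization gives
density. -/

/-- `T` is a strongly continuous one-parameter unitary group. -/
structure IsUnitaryGroup (T : ℝ → H ≃ₗᵢ[ℂ] H) : Prop where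
  map_zero : T 0 = 1
  map_add : ∀ s t, T (s + t) = T s * T t
  continuous : ∀ ψ, Continuous fun t => T t ψ

/-- `i φ` is the derivative of `T t ψ` at `t = 0`. -/
def GeneratesAt (T : ℝ → H ≃ₗᵢ[ℂ] H) (ψ φ : H) : Prop :=
  Tendsto (fun t : ℝ => ((t : ℂ)⁻¹) • (T t ψ - ψ)) (𝓝[≠] 0) (𝓝 (Complex.I • φ))

/-- Links the complex difference quotients of `IsExpI` to real derivatives, so that the product rule
and the fundamental theorem of calculus apply. -/
lemma tendsto_smul_sub_iff_hasDerivAt {f : ℝ → H} {f' : H} :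
    Tendsto (fun t : ℝ => ((t : ℂ)⁻¹) • (f t - f 0)) (𝓝[≠] 0) (𝓝 f') ↔ HasDerivAt f f' 0 := by
  rw [hasDerivAt_iff_tendsto_slope_zero]
  simp only [zero_add]
  refine tendsto_congr fun t => ?_
  rw [← Complex.ofReal_inv, Complex.coe_smul]

lemma inner_apply_left (W : H ≃ₗᵢ[ℂ] H) (ψ φ : H) : ⟪W ψ, φ⟫_ℂ = ⟪ψ, W⁻¹ φ⟫_ℂ := by
  rw [← W.inner_map_map ψ (W⁻¹ φ)]
  congr 1
  exact (W.apply_symm_apply φ).symm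

namespace IsUnitaryGroup

variable {T : ℝ → H ≃ₗᵢ[ℂ] H} (hT : IsUnitaryGroup T)
include hT

lemma map_neg (t : ℝ) : T (-t) = (T t)⁻¹ := by
  rw [eq_inv_iff_mul_eq_one, ← hT.map_add, neg_add_cancel, hT.map_zero]

lemma add_apply (s t : ℝ) (ψ : H) : T (s + t) ψ = T s (T t ψ) := by
  rw [hT.map_add]; rfl

lemma generatesAt_iff {ψ φ : H} :
    GeneratesAt T ψ φ ↔ HasDerivAt (fun t => T t ψ) (Complex.I • φ) 0 := by
  rw [← tendsto_smul_sub_iff_hasDerivAt, GeneratesAt, hT.map_zero]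
  rfl

/-- By `T s = T t * T (s - t)`, differentiability at `0` is transported to every time. -/
lemma hasDerivAt {ψ φ : H} (h : GeneratesAt T ψ φ) (t : ℝ) :
    HasDerivAt (fun s => T s ψ) (Complex.I • T t φ) t := by
  have h0 : HasDerivAt (fun s => T s ψ) (Complex.I • φ) (t - t) := by
    rw [sub_self]; exact hT.generatesAt_iff.1 h
  have h1 := ((T t).toContinuousLinearEquiv.toContinuousLinearMap.restrictScalars ℝ).hasFDerivAt
    |>.comp_hasDerivAt t (h0.comp_sub_const t t)
  simp only [ContinuousLinearMap.coe_restrictScalars', ContinuousLinearEquiv.coe_coe,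
    LinearIsometryEquiv.coe_toContinuousLinearEquiv, map_smul] at h1
  refine h1.congr_of_eventuallyEq (Eventually.of_forall fun s => ?_)
  change T s ψ = T t (T (s - t) ψ)
  rw [← hT.add_apply, add_sub_cancel]

lemma hasDerivAt_neg {ψ φ : H} (h : GeneratesAt T ψ φ) :
    HasDerivAt (fun s => T (-s) ψ) (-(Complex.I • φ)) 0 := by
  have h0 : HasDerivAt (fun s => T s ψ) (Complex.I • φ) (-0) := by
    rw [neg_zero]; exact hT.generatesAt_iff.1 h
  simpa [Function.comp_def] using h0.scomp (0 : ℝ) (_root_.hasDerivAt_neg (0 : ℝ))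

/-- Symmetry of the generator: both sides of `⟪T t ψ, χ⟫ = ⟪ψ, T (-t) χ⟫` are differentiated at `0`.
-/
lemma inner_generatesAt {ψ φ χ η : H} (h : GeneratesAt T ψ φ) (h' : GeneratesAt T χ η) :
    ⟪φ, χ⟫_ℂ = ⟪ψ, η⟫_ℂ := by
  have h1 := (hT.generatesAt_iff.1 h).inner ℂ (hasDerivAt_const (0 : ℝ) χ)
  have h2 := (hasDerivAt_const (0 : ℝ) ψ).inner ℂ (hT.hasDerivAt_neg h')
  have h3 : (fun t : ℝ => ⟪T t ψ, χ⟫_ℂ) = fun t => ⟪ψ, T (-t) χ⟫_ℂ := by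
    ext t; rw [inner_apply_left, hT.map_neg]
  rw [h3] at h1
  have h4 := h1.unique h2
  simp only [inner_zero_right, inner_zero_left, zero_add, add_zero, inner_smul_left,
    inner_neg_right, inner_smul_right, Complex.conj_I, neg_mul, neg_inj] at h4
  exact mul_left_cancel₀ Complex.I_ne_zero h4

lemma generatesAt_apply {ψ φ : H} (h : GeneratesAt T ψ φ) (t : ℝ) :
    GeneratesAt T (T t ψ) (T t φ) := by
  have h1 : Tendsto _ _ _ := ((T t).continuous.tendsto _).comp h
  rw [GeneratesAt]
  refine (h1.congr fun s => ?_).trans (by rw [map_smul])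
  simp only [Function.comp_apply, map_smul, map_sub]
  rw [← hT.add_apply, ← hT.add_apply, add_comm]

end IsUnitaryGroup

end OneParameter

/-! ### Nelson's criterion: an invariant dense domain of differentiable vectors is a core. -/

section Nelson

variable {H : Type*} [NormedAddCommGroup H] [InnerProductSpace ℂ H]

/-- `A` is the restriction of the generator of `T` to a dense subspace invariant under `T`. -/
structure IsInvariantCore (A : H →ₗ.[ℂ] H) (T : ℝ → H ≃ₗᵢ[ℂ] H) : Prop where
  group : IsUnitaryGroup T
  dense : Dense (A.domain : Set H)
  mapsTo : ∀ t, ∀ ψ ∈ A.domain, T t ψ ∈ A.domain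
  generatesAt : ∀ ψ φ, (ψ, φ) ∈ A.graph → GeneratesAt T ψ φ

namespace IsInvariantCore

variable {A : H →ₗ.[ℂ] H} {T : ℝ → H ≃ₗᵢ[ℂ] H} (h : IsInvariantCore A T)
include h

/-- `A (T t ψ)` and `T t (A ψ)` both arise from the derivative at `0` of the orbit of `T t ψ`, so
they agree. -/
lemma map_graph {ψ φ : H} (hψ : (ψ, φ) ∈ A.graph) (t : ℝ) : (T t ψ, T t φ) ∈ A.graph := by
  have hd := h.mapsTo t ψ (LinearPMap.mem_domain_of_mem_graph hψ)
  obtain ⟨η, hη⟩ := LinearPMap.mem_domain_iff.1 hd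
  have h1 := tendsto_nhds_unique (h.generatesAt _ _ hη)
    (h.group.generatesAt_apply (h.generatesAt _ _ hψ) t)
  rw [smul_right_injective _ Complex.I_ne_zero h1] at hη
  exact hη

/-- The deficiency subspaces of `A` are trivial. -/
lemma eq_zero_of_inner {c : ℝ} (hc : c ≠ 0) {x : H}
    (hx : ∀ ψ φ, (ψ, φ) ∈ A.graph → ⟪x, φ⟫_ℂ = (c * Complex.I) * ⟪x, ψ⟫_ℂ) : x = 0 := by
  refine h.dense.eq_zero_of_inner_left ℂ fun ψ hψ => ?_
  obtain ⟨φ, hφ⟩ := LinearPMap.mem_domain_iff.1 hψ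
  -- The orbit stays in the domain, so the hypothesis on `x` applies to `T t ψ` at every time and
  -- gives the equation `u' = -c u`.
  have hd : ∀ t : ℝ, HasDerivAt (fun t => ⟪x, T t ψ⟫_ℂ) (-(c : ℂ) * ⟪x, T t ψ⟫_ℂ) t := by
    intro t
    have h1 := (hasDerivAt_const t x).inner ℂ (h.group.hasDerivAt (h.generatesAt _ _ hφ) t)
    rw [inner_zero_left, add_zero, inner_smul_right, hx _ _ (h.map_graph hφ t)] at h1
    convert! h1 using 1
    linear_combination (-(c : ℂ) * ⟪x, T t ψ⟫_ℂ) * Complex.I_mul_I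
  have hconst : ∀ t : ℝ, Complex.exp (c * t) * ⟪x, T t ψ⟫_ℂ = ⟪x, ψ⟫_ℂ := by
    have hd' : ∀ t : ℝ, HasDerivAt (fun t : ℝ => Complex.exp (c * t) * ⟪x, T t ψ⟫_ℂ) 0 t := by
      intro t
      have h1 : HasDerivAt (fun t : ℝ => Complex.exp (c * t)) (Complex.exp (c * t) * c) t := by
        simpa using ((Complex.ofRealCLM.hasDerivAt (x := t)).const_mul (c : ℂ)).cexp
      convert! h1.mul (hd t) using 1
      ring
    intro t
    have := is_const_of_deriv_eq_zero (fun t => (hd' t).differentiableAt)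
      (fun t => (hd' t).deriv) t 0
    simpa [h.group.map_zero] using this
  have hb : ∀ t : ℝ, ‖⟪x, ψ⟫_ℂ‖ ≤ Real.exp (c * t) * (‖x‖ * ‖ψ‖) := by
    intro t
    rw [← hconst t, norm_mul, Complex.norm_exp]
    have h1 : ((c : ℂ) * t).re = c * t := by simp
    rw [h1]
    gcongr
    exact (norm_inner_le_norm _ _).trans_eq (by rw [LinearIsometryEquiv.norm_map])
  -- The times `-t / c` turn the exponential into `e^{-t}`, whatever the sign of `c`.
  have hlim : Tendsto (fun t : ℝ => Real.exp (c * (-c⁻¹ * t)) * (‖x‖ * ‖ψ‖)) atTop (𝓝 0) := by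
    have : Tendsto (fun t : ℝ => Real.exp (-t) * (‖x‖ * ‖ψ‖)) atTop (𝓝 (0 * (‖x‖ * ‖ψ‖))) :=
      (Real.tendsto_exp_neg_atTop_nhds_zero).mul_const _
    rw [zero_mul] at this
    refine this.congr fun t => ?_
    congr 2
    field_simp
  have := ge_of_tendsto' hlim fun t => hb (-c⁻¹ * t)
  exact norm_le_zero_iff.1 this

lemma inner_of_mem_closure {x y : H × H} (hx : x ∈ A.graph.topologicalClosure)
    (hy : y ∈ A.graph.topologicalClosure) : ⟪x.2, y.1⟫_ℂ = ⟪x.1, y.2⟫_ℂ := by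
  have hclosed : IsClosed {p : (H × H) × (H × H) | ⟪p.1.2, p.2.1⟫_ℂ = ⟪p.1.1, p.2.2⟫_ℂ} :=
    isClosed_eq (by fun_prop) (by fun_prop)
  have h1 : ((A.graph : Set (H × H)) ×ˢ (A.graph : Set (H × H))) ⊆
      {p : (H × H) × (H × H) | ⟪p.1.2, p.2.1⟫_ℂ = ⟪p.1.1, p.2.2⟫_ℂ} := fun p hp =>
    h.group.inner_generatesAt (h.generatesAt _ _ hp.1) (h.generatesAt _ _ hp.2)
  have h2 := closure_minimal h1 hclosed
  rw [closure_prod_eq] at h2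
  exact h2 (Set.mk_mem_prod hx hy)

variable [CompleteSpace H]

/-- The operator `A + i` maps the domain of the closure of `A` onto the whole space. -/
lemma exists_mem_closure (y : H) :
    ∃ x ∈ A.graph.topologicalClosure, x.2 + Complex.I • x.1 = y := by
  set Γ := A.graph.topologicalClosure
  have : CompleteSpace Γ := A.graph.isClosed_topologicalClosure.completeSpace_coe
  let L : Γ →L[ℂ] H := (ContinuousLinearMap.snd ℂ H H + Complex.I • ContinuousLinearMap.fst ℂ H H)
    ∘L Γ.subtypeL
  have hL : ∀ x : Γ, L x = x.1.2 + Complex.I • x.1.1 := fun x => rfl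
  -- By symmetry `⟪x₂, x₁⟫` is real, so the cross term drops out and `‖x₂ + i x₁‖² = ‖x₁‖² + ‖x₂‖²`.
  -- Hence `L` is bounded below and its range is closed.
  have hnorm : ∀ x : Γ, ‖x‖ ≤ ‖L x‖ := by
    intro x
    have h0 : (⟪x.1.2, Complex.I • x.1.1⟫_ℂ).re = 0 := by
      have h1 := h.inner_of_mem_closure x.2 x.2
      have h2 := inner_conj_symm (𝕜 := ℂ) x.1.2 x.1.1
      rw [← h1, Complex.conj_eq_iff_im] at h2
      rw [inner_smul_right, Complex.mul_re, h2]
      simp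
    have h1 := norm_add_sq (𝕜 := ℂ) x.1.2 (Complex.I • x.1.1)
    rw [← hL] at h1
    simp only [RCLike.re_to_complex, h0, norm_smul, Complex.norm_I, one_mul, mul_zero,
      add_zero] at h1
    change max ‖x.1.1‖ ‖x.1.2‖ ≤ _
    refine max_le ?_ ?_ <;> refine (sq_le_sq₀ (norm_nonneg _) (norm_nonneg _)).1 ?_ <;>
      nlinarith [sq_nonneg ‖x.1.1‖, sq_nonneg ‖x.1.2‖]
  have hanti : AntilipschitzWith 1 L :=
    L.antilipschitz_of_bound fun x => by simpa using hnorm x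
  have hclosed : IsClosed (LinearMap.range L.toLinearMap : Set H) := by
    rw [LinearMap.coe_range]
    exact hanti.isClosed_range L.uniformContinuous
  have htop : LinearMap.range L.toLinearMap = ⊤ := by
    rw [← hclosed.submodule_topologicalClosure_eq, Submodule.topologicalClosure_eq_top_iff,
      Submodule.eq_bot_iff]
    intro x hx
    refine h.eq_zero_of_inner (c := -1) (by norm_num) fun ψ φ hφ => ?_
    have h1 := inner_eq_zero_symm.1 ((Submodule.mem_orthogonal _ _).1 hx
      (L ⟨(ψ, φ), A.graph.le_topologicalClosure hφ⟩) ⟨_, rfl⟩)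
    rw [hL, inner_add_right, inner_smul_right] at h1
    push_cast
    linear_combination h1
  obtain ⟨x, hx⟩ := LinearMap.range_eq_top.1 htop y
  exact ⟨x.1, x.2, hx⟩

/-- The adjoint of `A` is contained in the closure of `A`. -/
lemma mem_closure_of_inner {φ η : H} (hφ : ∀ ψ χ, (ψ, χ) ∈ A.graph → ⟪φ, χ⟫_ℂ = ⟪η, ψ⟫_ℂ) :
    (φ, η) ∈ A.graph.topologicalClosure := by
  -- The pair `(φ, η)` is in the graph of the adjoint. Solving `(closure of A + i) x₁ = η + i φ`
  -- makes `x₁ - φ` a solution of the deficiency equation with `c = 1`, hence zero.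
  obtain ⟨x, hx, hx'⟩ := h.exists_mem_closure (η + Complex.I • φ)
  have h0 : x.1 - φ = 0 := by
    refine h.eq_zero_of_inner (c := 1) (by norm_num) fun ψ χ hχ => ?_
    have h1 := h.inner_of_mem_closure hx (A.graph.le_topologicalClosure hχ)
    have h2 := congrArg (fun y => ⟪y, ψ⟫_ℂ) hx'
    simp only [inner_add_left, inner_smul_left, Complex.conj_I] at h2
    simp only [inner_sub_left, hφ _ _ hχ] at h1 ⊢
    push_cast
    linear_combination h2 - h1
  have h1 : x.1 = φ := sub_eq_zero.1 h0
  have h2 : x.2 = η := by rw [h1] at hx'; exact add_right_cancel hx'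
  rw [← h1, ← h2]; exact hx

/-- A symmetric operator is contained in its adjoint, which is closed. -/
lemma isClosable : A.IsClosable := by
  refine LinearPMap.isClosable_iff_exists_closed_extension.2
    ⟨A.adjoint, LinearPMap.adjoint_isClosed h.dense, LinearPMap.le_of_le_graph ?_⟩
  rw [LinearPMap.adjoint_graph_eq_graph_adjoint h.dense]
  intro x hx
  rw [Submodule.mem_adjoint_iff]
  intro a b hab
  rw [sub_eq_zero]
  exact h.inner_of_mem_closure (A.graph.le_topologicalClosure hab)
    (A.graph.le_topologicalClosure hx)

theorem isEssentiallySelfAdjoint : IsEssentiallySelfAdjoint A := by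
  refine ⟨h.dense, h.isClosable, ?_⟩
  rw [LinearPMap.isSelfAdjoint_def]
  refine LinearPMap.eq_of_eq_graph ?_
  rw [LinearPMap.adjoint_graph_eq_graph_adjoint (h.dense.mono A.le_closure.1),
    ← h.isClosable.graph_closure_eq_closure_graph]
  ext x
  rw [Submodule.mem_adjoint_iff]
  refine ⟨fun hx => h.mem_closure_of_inner fun ψ χ hχ => ?_, fun hx a b hab => ?_⟩
  · have h1 := sub_eq_zero.1 (hx _ _ (A.graph.le_topologicalClosure hχ))
    rw [← inner_conj_symm, h1, inner_conj_symm]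
  · rw [sub_eq_zero]
    exact h.inner_of_mem_closure hab hx

/-- The integrated form of the evolution equation passes to limits in the graph, which the
derivative at `0` does not do directly. In `mem_graph_closure_iff` the fundamental theorem of
calculus recovers the derivative from it. -/
lemma integral_eq_of_mem_closure {x : H × H} (hx : x ∈ A.graph.topologicalClosure) (t : ℝ) :
    ∫ s in (0 : ℝ)..t, Complex.I • T s x.2 = T t x.1 - x.1 := by
  have hcont : Continuous fun p : (H × H) × ℝ => Complex.I • T p.2 p.1.2 := by
    refine Continuous.const_smul ?_ _
    have h1 : Continuous fun p : H × ℝ => T p.2 p.1 :=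
      continuous_prod_of_continuous_lipschitzWith _ 1 h.group.continuous
        fun s => (T s).lipschitz
    exact h1.comp (continuous_fst.snd.prodMk continuous_snd)
  have hclosed : IsClosed {x : H × H | ∫ s in (0 : ℝ)..t, Complex.I • T s x.2 = T t x.1 - x.1} :=
    isClosed_eq (intervalIntegral.continuous_parametric_intervalIntegral_of_continuous' hcont 0 t)
      (by fun_prop)
  refine closure_minimal (fun y hy => ?_) hclosed hx
  have h1 : Continuous fun s => Complex.I • T s y.2 :=
    hcont.comp (continuous_const.prodMk continuous_id : Continuous fun s : ℝ => (y, s))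
  refine (intervalIntegral.integral_eq_sub_of_hasDerivAt
    (fun s _ => h.group.hasDerivAt (h.generatesAt _ _ hy) s)
    (h1.intervalIntegrable _ _)).trans ?_
  rw [h.group.map_zero]; rfl

/-- The closure of `A` is the generator of `T`. -/
theorem mem_graph_closure_iff (ψ φ : H) : (ψ, φ) ∈ A.closure.graph ↔ GeneratesAt T ψ φ := by
  rw [← h.isClosable.graph_closure_eq_closure_graph]
  refine ⟨fun hψ => ?_, fun hψ => h.mem_closure_of_inner fun χ η hη => ?_⟩
  · have h1 : Continuous fun s => Complex.I • T s φ := (h.group.continuous φ).const_smul _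
    have h2 := intervalIntegral.integral_hasDerivAt_right (h1.intervalIntegrable 0 0)
      (h1.stronglyMeasurableAtFilter _ _) h1.continuousAt
    rw [h.group.generatesAt_iff]
    simp only [fun t => h.integral_eq_of_mem_closure hψ t] at h2
    have h3 := h2.add_const ψ
    simpa [h.group.map_zero] using h3
  -- The generator of `T` is symmetric against `A`, hence contained in the adjoint of `A`, hence in
  -- the closure.
  · exact (h.group.inner_generatesAt hψ (h.generatesAt _ _ hη)).symm

theorem isExpI : IsExpI A.closure (T 1) :=
  ⟨T, h.group.map_zero, h.group.map_add, h.group.continuous, h.mem_graph_closure_iff, rfl⟩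

-- It is enough that the generator of the competing group `S` extends `A`: on the `T`-invariant
-- domain, symmetry makes the derivative of `⟪S t ψ, T t χ⟫` vanish, so `S 1` and `T 1` agree on a
-- dense set.
omit [CompleteSpace H] in
theorem isExpI_unique {W : H ≃ₗᵢ[ℂ] H} (hW : IsExpI A.closure W) : W = T 1 := by
  obtain ⟨S, hS0, hSadd, hScont, hSgen, rfl⟩ := hW
  have hS : IsUnitaryGroup S := ⟨hS0, hSadd, hScont⟩
  have hgen : ∀ ψ φ, (ψ, φ) ∈ A.graph → GeneratesAt S ψ φ := fun ψ φ hψ =>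
    (hSgen ψ φ).1 (LinearPMap.le_graph_of_le A.le_closure hψ)
  have key : ∀ ψ ∈ A.domain, ∀ χ ∈ A.domain, ⟪S 1 ψ, T 1 χ⟫_ℂ = ⟪ψ, χ⟫_ℂ := by
    intro ψ hψ χ hχ
    obtain ⟨φ, hφ⟩ := LinearPMap.mem_domain_iff.1 hψ
    obtain ⟨η, hη⟩ := LinearPMap.mem_domain_iff.1 hχ
    have hd : ∀ t : ℝ, HasDerivAt (fun t => ⟪S t ψ, T t χ⟫_ℂ) 0 t := by
      intro t
      have h1 := (hS.hasDerivAt (hgen _ _ hφ) t).inner ℂ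
        (h.group.hasDerivAt (h.generatesAt _ _ hη) t)
      have h2 := hS.inner_generatesAt (hS.generatesAt_apply (hgen _ _ hφ) t)
        (hgen _ _ (h.map_graph hη t))
      rw [inner_smul_left, inner_smul_right, h2, Complex.conj_I] at h1
      convert! h1 using 1
      ring
    have := is_const_of_deriv_eq_zero (fun t => (hd t).differentiableAt) (fun t => (hd t).deriv) 1 0
    simpa [hS0, h.group.map_zero] using this
  ext ψ
  have h1 : ∀ ψ ∈ A.domain, ∀ χ, ⟪S 1 ψ, T 1 χ⟫_ℂ = ⟪ψ, χ⟫_ℂ := fun ψ hψ χ =>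
    h.dense.induction (P := fun χ => ⟪S 1 ψ, T 1 χ⟫_ℂ = ⟪ψ, χ⟫_ℂ) (key ψ hψ)
      (isClosed_eq (by fun_prop) (by fun_prop)) χ
  have h2 : ∀ ψ ∈ A.domain, S 1 ψ = T 1 ψ := by
    intro ψ hψ
    refine ext_inner_right ℂ fun χ => ?_
    obtain ⟨χ, rfl⟩ := (T 1).surjective χ
    rw [h1 ψ hψ, LinearIsometryEquiv.inner_map_map]
  exact h.dense.induction (P := fun ψ => S 1 ψ = T 1 ψ) h2
    (isClosed_eq (by fun_prop) (by fun_prop)) ψ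

end IsInvariantCore

end Nelson

/-! ### Commuting operators integrated by a unitary representation -/

/-! ### Graphs of sums, multiples and restrictions of partially defined operators. -/

section Graphs

variable {H : Type*} [NormedAddCommGroup H] [InnerProductSpace ℂ H]

lemma mem_graph_add_iff {f g : H →ₗ.[ℂ] H} {ψ φ : H} :
    (ψ, φ) ∈ (f + g).graph ↔
      ∃ a b, (ψ, a) ∈ f.graph ∧ (ψ, b) ∈ g.graph ∧ φ = a + b := by
  constructor
  · intro h
    obtain ⟨x, hx, hx'⟩ := (LinearPMap.mem_graph_iff _).1 h
    refine ⟨f ⟨x, x.2.1⟩, g ⟨x, x.2.2⟩, ?_, ?_, hx'.symm⟩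
    · exact (LinearPMap.mem_graph_iff _).2 ⟨⟨x, x.2.1⟩, hx, rfl⟩
    · exact (LinearPMap.mem_graph_iff _).2 ⟨⟨x, x.2.2⟩, hx, rfl⟩
  · rintro ⟨a, b, ha, hb, rfl⟩
    obtain ⟨x, rfl, rfl⟩ := (LinearPMap.mem_graph_iff _).1 ha
    obtain ⟨y, hy, rfl⟩ := (LinearPMap.mem_graph_iff _).1 hb
    refine (LinearPMap.mem_graph_iff _).2 ⟨⟨x, x.2, LinearPMap.mem_domain_of_mem_graph hb⟩, rfl, ?_⟩
    rw [LinearPMap.add_apply]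
    congr 2
    exact Subtype.ext hy.symm

lemma mem_graph_sum_iff {ι : Type*} {s : Finset ι} {f : ι → H →ₗ.[ℂ] H} {ψ φ : H} :
    (ψ, φ) ∈ (∑ i ∈ s, f i).graph ↔
      ∃ a : ι → H, (∀ i ∈ s, (ψ, a i) ∈ (f i).graph) ∧ φ = ∑ i ∈ s, a i := by
  classical
  induction s using Finset.induction_on generalizing φ with
  | empty =>
    simp only [Finset.sum_empty, Finset.notMem_empty, IsEmpty.forall_iff, implies_true, true_and,
      exists_const, LinearPMap.mem_graph_iff]
    constructor
    · rintro ⟨x, -, h⟩; exact h.symm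
    · rintro rfl; exact ⟨⟨ψ, trivial⟩, rfl, rfl⟩
  | insert i s hi ih =>
    rw [Finset.sum_insert hi, mem_graph_add_iff]
    constructor
    · rintro ⟨a, b, ha, hb, rfl⟩
      obtain ⟨c, hc, rfl⟩ := ih.1 hb
      refine ⟨Function.update c i a, fun j hj => ?_, ?_⟩
      · rcases eq_or_ne j i with rfl | hji
        · simpa using ha
        · simpa [hji] using hc j ((Finset.mem_insert.1 hj).resolve_left hji)
      · rw [Finset.sum_insert hi, Function.update_self]
        congr 1
        refine Finset.sum_congr rfl fun j hj => ?_
        rw [Function.update_of_ne (ne_of_mem_of_not_mem hj hi)]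
    · rintro ⟨a, ha, rfl⟩
      refine ⟨a i, ∑ j ∈ s, a j, ha i (Finset.mem_insert_self _ _),
        ih.2 ⟨a, fun j hj => ha j (Finset.mem_insert_of_mem hj), rfl⟩, Finset.sum_insert hi⟩

lemma mem_graph_domRestrict_iff {f : H →ₗ.[ℂ] H} {D : Submodule ℂ H} {ψ φ : H} :
    (ψ, φ) ∈ (f.domRestrict D).graph ↔ ψ ∈ D ∧ (ψ, φ) ∈ f.graph := by
  constructor
  · intro h
    obtain ⟨x, rfl, rfl⟩ := (LinearPMap.mem_graph_iff _).1 h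
    exact ⟨x.2.1, (LinearPMap.mem_graph_iff _).2 ⟨⟨x, x.2.2⟩, rfl, rfl⟩⟩
  · rintro ⟨hD, h⟩
    obtain ⟨x, rfl, rfl⟩ := (LinearPMap.mem_graph_iff _).1 h
    exact (LinearPMap.mem_graph_iff _).2 ⟨⟨x, hD, x.2⟩, rfl, rfl⟩

lemma mem_graph_smul {f : H →ₗ.[ℂ] H} {c : ℂ} {ψ φ : H} (h : (ψ, φ) ∈ (c • f).graph) :
    ∃ a, (ψ, a) ∈ f.graph ∧ φ = c • a := by
  obtain ⟨x, rfl, rfl⟩ := (LinearPMap.mem_graph_iff _).1 h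
  exact ⟨f x, (LinearPMap.mem_graph_iff _).2 ⟨x, rfl, rfl⟩, rfl⟩

lemma mem_graph_contraction {d : ℕ} {X : Fin d → (H →ₗ.[ℂ] H)} {D : Submodule ℂ H}
    {p : Fin d → ℝ} {ψ φ : H} (h : (ψ, φ) ∈ (contraction X D p).graph) :
    ∃ a : Fin d → H, (∀ μ, (ψ, a μ) ∈ (X μ).graph) ∧ φ = ∑ μ, (p μ : ℂ) • a μ := by
  obtain ⟨b, hb, rfl⟩ := mem_graph_sum_iff.1 h
  choose a ha hab using fun μ => mem_graph_smul (hb μ (Finset.mem_univ μ))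
  exact ⟨a, fun μ => (mem_graph_domRestrict_iff.1 (ha μ)).2,
    Finset.sum_congr rfl fun μ _ => hab μ⟩

/-- The index set must be nonempty, since an empty sum is the zero operator on the whole space.
Vanishing coefficients do no harm: `0 • f` keeps the domain of `f`. -/
lemma domain_contraction {n : ℕ} {X : Fin (n + 1) → (H →ₗ.[ℂ] H)} {D : Submodule ℂ H}
    (hD : ∀ μ, D ≤ (X μ).domain) (p : Fin (n + 1) → ℝ) : (contraction X D p).domain = D := by
  ext ψ
  constructor
  · intro h
    obtain ⟨φ, hφ⟩ := LinearPMap.mem_domain_iff.1 h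
    obtain ⟨b, hb, -⟩ := mem_graph_sum_iff.1 hφ
    obtain ⟨a, ha, -⟩ := mem_graph_smul (hb 0 (Finset.mem_univ _))
    exact (mem_graph_domRestrict_iff.1 ha).1
  · intro h
    choose a ha using fun μ => LinearPMap.mem_domain_iff.1
      (show ψ ∈ ((p μ : ℂ) • (X μ).domRestrict D).domain from ⟨h, hD μ h⟩)
    exact LinearPMap.mem_domain_iff.2 ⟨_, mem_graph_sum_iff.2 ⟨a, fun μ _ => ha μ, rfl⟩⟩

end Graphs

/-! ### Joint generators of a unitary representation of `ℝ^d`. -/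

section Integrates

variable {H : Type*} [NormedAddCommGroup H] [InnerProductSpace ℂ H] {d : ℕ}

/-- `U` is a strongly continuous unitary representation of `ℝ^d` which leaves the dense domain `D`
invariant, and whose generators act on `D` as the operators `X μ`, which leave `D` invariant. -/
structure Integrates (U : (Fin d → ℝ) → (H ≃ₗᵢ[ℂ] H)) (X : Fin d → (H →ₗ.[ℂ] H))
    (D : Submodule ℂ H) : Prop where
  dense : Dense (D : Set H)
  map_zero : U 0 = 1
  map_add : ∀ p q, U (p + q) = U p * U q
  continuous : ∀ ψ ∈ D, Continuous fun p => U p ψ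
  mapsTo : ∀ p, ∀ ψ ∈ D, U p ψ ∈ D
  exists_graph : ∀ μ, ∀ ψ ∈ D, ∃ φ ∈ D, (ψ, φ) ∈ (X μ).graph
  generatesAt : ∀ p, ∀ ψ ∈ D, ∀ φ : Fin d → H, (∀ μ, (ψ, φ μ) ∈ (X μ).graph) →
    GeneratesAt (fun t : ℝ => U (t • p)) ψ (∑ μ, (p μ : ℂ) • φ μ)

namespace Integrates

variable {U : (Fin d → ℝ) → (H ≃ₗᵢ[ℂ] H)} {X : Fin d → (H →ₗ.[ℂ] H)} {D : Submodule ℂ H}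
  (h : Integrates U X D)
include h

/-- The operators `U p` are all `1`-Lipschitz, so strong continuity extends from the dense domain to
every vector. -/
lemma continuous_apply (ψ : H) : Continuous fun p => U p ψ := by
  have hc : Continuous fun x : (Fin d → ℝ) × H => U x.1 x.2 :=
    continuous_prod_of_dense_continuous_lipschitzWith' _ 1 h.dense
      (fun p => (U p).lipschitz) h.continuous
  exact hc.comp (continuous_id.prodMk continuous_const)

lemma isUnitaryGroup (p : Fin d → ℝ) : IsUnitaryGroup fun t : ℝ => U (t • p) where
  map_zero := by simp [h.map_zero]
  map_add s t := by rw [add_smul, h.map_add]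
  continuous ψ := (h.continuous_apply ψ).comp (by fun_prop)

lemma le_domain (μ : Fin d) : D ≤ (X μ).domain := fun ψ hψ => by
  obtain ⟨φ, -, hφ⟩ := h.exists_graph μ ψ hψ
  exact LinearPMap.mem_domain_of_mem_graph hφ

lemma mem_of_graph {μ : Fin d} {ψ φ : H} (hψ : ψ ∈ D) (hφ : (ψ, φ) ∈ (X μ).graph) : φ ∈ D := by
  obtain ⟨φ', hφ', hg⟩ := h.exists_graph μ ψ hψ
  rwa [LinearPMap.mem_graph_snd_inj _ hφ hg rfl]

lemma isInvariantCore (p : Fin d → ℝ) {A : H →ₗ.[ℂ] H} (hdom : A.domain = D)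
    (hA : ∀ ψ φ, (ψ, φ) ∈ A.graph →
      ∃ a : Fin d → H, (∀ μ, (ψ, a μ) ∈ (X μ).graph) ∧ φ = ∑ μ, (p μ : ℂ) • a μ) :
    IsInvariantCore A fun t : ℝ => U (t • p) where
  group := h.isUnitaryGroup p
  dense := hdom ▸ h.dense
  mapsTo t ψ hψ := by rw [hdom] at hψ ⊢; exact h.mapsTo _ ψ hψ
  generatesAt ψ φ hψ := by
    obtain ⟨a, ha, rfl⟩ := hA ψ φ hψ
    exact h.generatesAt p ψ (hdom ▸ LinearPMap.mem_domain_of_mem_graph hψ) a ha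

lemma generatesAt_single {μ : Fin d} {ψ φ : H} (hψ : ψ ∈ D) (hφ : (ψ, φ) ∈ (X μ).graph) :
    GeneratesAt (fun t : ℝ => U (t • Pi.single μ 1)) ψ φ := by
  choose a haD ha using fun ν => h.exists_graph ν ψ hψ
  have h1 := h.generatesAt (Pi.single μ 1) ψ hψ a ha
  have h2 : ∑ ν, ((Pi.single μ 1 : Fin d → ℝ) ν : ℂ) • a ν = φ := by
    rw [Finset.sum_eq_single μ (fun ν _ hν => by simp [hν]) (by simp)]
    simpa using LinearPMap.mem_graph_snd_inj _ (ha μ) hφ rfl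
  rwa [h2] at h1

lemma isInvariantCore_domRestrict (μ : Fin d) :
    IsInvariantCore ((X μ).domRestrict D) fun t : ℝ => U (t • Pi.single μ 1) where
  group := h.isUnitaryGroup _
  dense := h.dense.mono fun ψ hψ => ⟨hψ, h.le_domain μ hψ⟩
  mapsTo t ψ hψ := ⟨h.mapsTo _ ψ hψ.1, h.le_domain μ (h.mapsTo _ ψ hψ.1)⟩
  generatesAt ψ φ hψ := by
    obtain ⟨hD, hg⟩ := mem_graph_domRestrict_iff.1 hψ
    exact h.generatesAt_single hD hg

/-- On `D`, the generators commute in the sense of quadratic forms. -/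
lemma inner_comm {μ ν : Fin d} {χ χ₁ χ₂ ψ ψ₁ ψ₂ : H} (hχ : χ ∈ D) (hψ : ψ ∈ D)
    (hχ₁ : (χ, χ₁) ∈ (X μ).graph) (hχ₂ : (χ, χ₂) ∈ (X ν).graph)
    (hψ₁ : (ψ, ψ₁) ∈ (X μ).graph) (hψ₂ : (ψ, ψ₂) ∈ (X ν).graph) :
    ⟪χ₁, ψ₂⟫_ℂ = ⟪χ₂, ψ₁⟫_ℂ := by
  have hμ := h.isUnitaryGroup (Pi.single μ 1)
  have hν := h.isUnitaryGroup (Pi.single ν 1)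
  -- `U` in direction `ν` commutes with the group in direction `μ`, hence with its symmetric
  -- generator. The derivative of this identity at `t = 0` is the claim.
  have key : ∀ t : ℝ, ⟪χ₁, U (t • Pi.single ν 1) ψ⟫_ℂ = ⟪U ((-t) • Pi.single ν 1) χ, ψ₁⟫_ℂ := by
    intro t
    have hcomm : (fun s : ℝ => U (s • Pi.single μ 1) (U ((-t) • Pi.single ν 1) χ)) =
        fun s => U ((-t) • Pi.single ν 1) (U (s • Pi.single μ 1) χ) := by
      ext s
      have : U (s • Pi.single μ 1) * U ((-t) • Pi.single ν 1) =
          U ((-t) • Pi.single ν 1) * U (s • Pi.single μ 1) := by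
        rw [← h.map_add, ← h.map_add, add_comm]
      exact DFunLike.congr_fun this χ
    have h1 : GeneratesAt (fun s : ℝ => U (s • Pi.single μ 1)) (U ((-t) • Pi.single ν 1) χ)
        (U ((-t) • Pi.single ν 1) χ₁) := by
      rw [hμ.generatesAt_iff, hcomm]
      have h2 := ((U ((-t) • Pi.single ν 1)).toContinuousLinearEquiv.toContinuousLinearMap.restrictScalars
        ℝ).hasFDerivAt.comp_hasDerivAt 0
        (hμ.generatesAt_iff.1 (h.generatesAt_single hχ hχ₁))
      simpa [Function.comp_def] using h2
    have h2 := hμ.inner_generatesAt h1 (h.generatesAt_single hψ hψ₁)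
    rw [← h2, inner_apply_left, ← hν.map_neg (-t), neg_neg]
  have h1 := (hasDerivAt_const (0 : ℝ) χ₁).inner ℂ
    (hν.generatesAt_iff.1 (h.generatesAt_single hψ hψ₂))
  have h2 := (hν.hasDerivAt_neg (h.generatesAt_single hχ hχ₂)).inner ℂ
    (hasDerivAt_const (0 : ℝ) ψ₁)
  simp only [key] at h1
  have h3 := h1.unique h2
  simp only [inner_zero_right, inner_zero_left, zero_add, add_zero, inner_smul_left,
    inner_neg_left, inner_smul_right, Complex.conj_I, neg_mul, neg_neg] at h3
  exact mul_left_cancel₀ Complex.I_ne_zero h3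

/-- Tested against `χ ∈ D`, each product has its outer operator moved to `χ` by symmetry;
`inner_comm` then identifies the two terms. -/
lemma commuteOn (μ ν : Fin d) : CommuteOn (X μ) (X ν) D := by
  intro ψ hψ
  have hμ := h.le_domain μ hψ
  have hν := h.le_domain ν hψ
  have gμ := (X μ).mem_graph ⟨ψ, hμ⟩
  have gν := (X ν).mem_graph ⟨ψ, hν⟩
  have dμ := h.mem_of_graph hψ gμ
  have dν := h.mem_of_graph hψ gν
  refine ⟨hμ, hν, h.le_domain μ dν, h.le_domain ν dμ, ?_⟩
  refine h.dense.eq_zero_of_inner_right ℂ fun χ hχ => ?_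
  obtain ⟨χ₁, -, hχ₁⟩ := h.exists_graph μ χ hχ
  obtain ⟨χ₂, -, hχ₂⟩ := h.exists_graph ν χ hχ
  have e1 := (h.isUnitaryGroup (Pi.single μ 1)).inner_generatesAt (h.generatesAt_single hχ hχ₁)
    (h.generatesAt_single dν ((X μ).mem_graph ⟨_, h.le_domain μ dν⟩))
  have e2 := (h.isUnitaryGroup (Pi.single ν 1)).inner_generatesAt (h.generatesAt_single hχ hχ₂)
    (h.generatesAt_single dμ ((X ν).mem_graph ⟨_, h.le_domain ν dμ⟩))
  rw [inner_sub_right, ← e1, ← e2, h.inner_comm hχ hψ hχ₁ hχ₂ gμ gν, sub_self]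

theorem isCommutingEssSelfAdjoint [CompleteSpace H] : IsCommutingEssSelfAdjoint X D where
  dense := h.dense
  le_domain := h.le_domain
  essSelfAdjoint μ := (h.isInvariantCore_domRestrict μ).isEssentiallySelfAdjoint
  mapsTo μ ψ hψ := h.mem_of_graph hψ ((X μ).mem_graph ψ)
  commute := h.commuteOn

end Integrates

theorem Integrates.generatesUnitaryGroup [CompleteSpace H] {n : ℕ}
    {U : (Fin (n + 1) → ℝ) → (H ≃ₗᵢ[ℂ] H)} {X : Fin (n + 1) → (H →ₗ.[ℂ] H)} {D : Submodule ℂ H}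
    (h : Integrates U X D) : GeneratesUnitaryGroup X D := by
  have hc : ∀ p, IsInvariantCore (contraction X D p) fun t : ℝ => U (t • p) := fun p =>
    h.isInvariantCore p (domain_contraction h.le_domain p) fun ψ φ => mem_graph_contraction
  refine ⟨fun p => (hc p).isEssentiallySelfAdjoint, U, fun p => ⟨?_, fun W hW => ?_⟩,
    h.map_zero, h.map_add, h.continuous_apply⟩
  · simpa using (hc p).isExpI
  · simpa using (hc p).isExpI_unique hW

/-! ### Unitary equivalence -/

lemma mem_graph_sandwich_iff {W' W : H ≃ₗᵢ[ℂ] H} {A : H →ₗ.[ℂ] H} {ψ φ : H} :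
    (ψ, φ) ∈ (sandwich W' A W).graph ↔ (W ψ, W'.symm φ) ∈ A.graph := by
  constructor
  · intro h
    obtain ⟨x, rfl, rfl⟩ := (LinearPMap.mem_graph_iff _).1 h
    refine (LinearPMap.mem_graph_iff _).2 ⟨⟨W x, x.2⟩, rfl, ?_⟩
    exact (W'.symm_apply_apply _).symm
  · intro h
    obtain ⟨x, hx, hφ⟩ := (LinearPMap.mem_graph_iff _).1 h
    have hψ : W ψ ∈ A.domain := LinearPMap.mem_domain_of_mem_graph h
    refine (LinearPMap.mem_graph_iff _).2 ⟨⟨ψ, hψ⟩, rfl, ?_⟩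
    change W' (A ⟨W ψ, hψ⟩) = φ
    have : x = ⟨W ψ, hψ⟩ := Subtype.ext hx
    rw [← this, hφ, W'.apply_symm_apply]

/-- `W'` and `W` are separate arguments because `opX` and `opXK` are built from `V.symm` and `V`
independently. -/
theorem Integrates.sandwich {U : (Fin d → ℝ) → (H ≃ₗᵢ[ℂ] H)} {X : Fin d → (H →ₗ.[ℂ] H)}
    {D : Submodule ℂ H} (h : Integrates U X D) (W' W : H ≃ₗᵢ[ℂ] H) (hW : W'.symm = W) :
    Integrates (fun p => W' * U p * W) (fun μ => sandwich W' (X μ) W)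
      (D.map W'.toLinearEquiv.toLinearMap) := by
  subst hW
  have hWW : ∀ ψ, W'.symm (W' ψ) = ψ := W'.symm_apply_apply
  refine ⟨?_, ?_, ?_, ?_, ?_, ?_, ?_⟩
  · exact W'.surjective.denseRange.dense_image W'.continuous h.dense
  · rw [h.map_zero, mul_one]; ext ψ; exact W'.apply_symm_apply ψ
  · intro p q
    ext ψ
    rw [h.map_add]
    exact congrArg (fun x => W' (U p x)) (hWW _).symm
  · rintro _ ⟨ψ, hψ, rfl⟩
    refine W'.continuous.comp (f := fun p => U p (W'.symm (W' ψ))) ?_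
    rw [hWW]
    exact h.continuous ψ hψ
  · rintro p _ ⟨ψ, hψ, rfl⟩
    refine ⟨_, h.mapsTo p ψ hψ, ?_⟩
    exact congrArg (fun x => W' (U p x)) (hWW _).symm
  · rintro μ _ ⟨ψ, hψ, rfl⟩
    obtain ⟨φ, hφ, hg⟩ := h.exists_graph μ ψ hψ
    refine ⟨W' φ, ⟨φ, hφ, rfl⟩, mem_graph_sandwich_iff.2 ?_⟩
    rw [hWW]
    convert! hg
    exact hWW _
  · rintro p _ ⟨ψ, hψ, rfl⟩ φ hφ
    have h1 := h.generatesAt p ψ hψ (fun μ => W'.symm (φ μ)) fun μ => by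
      have := mem_graph_sandwich_iff.1 (hφ μ)
      convert! this
      exact (hWW _).symm
    have h2 : Tendsto _ _ _ := (W'.continuous.tendsto _).comp h1
    rw [GeneratesAt]
    refine (h2.congr fun t => ?_).trans (by simp only [_root_.map_smul, map_sum, W'.apply_symm_apply]; rfl)
    change W' _ = (t : ℂ)⁻¹ • (W' (U (t • p) (W'.symm (W' ψ))) - W' ψ)
    rw [hWW, ← map_sub, ← map_smul]

/-! ### Restriction to an invariant subspace -/

/-- The restriction of a unitary operator to a subspace invariant under it and its inverse. -/
def restrictUnitary (K : Submodule ℂ H) (W W' : H ≃ₗᵢ[ℂ] H) (hW : ∀ ψ ∈ K, W ψ ∈ K)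
    (hW' : ∀ ψ ∈ K, W' ψ ∈ K) (hinv : W * W' = 1) : K ≃ₗᵢ[ℂ] K where
  toFun ψ := ⟨W ψ, hW ψ ψ.2⟩
  invFun ψ := ⟨W' ψ, hW' ψ ψ.2⟩
  left_inv ψ := Subtype.ext (DFunLike.congr_fun (mul_eq_one_comm.1 hinv) ψ.1)
  right_inv ψ := Subtype.ext (DFunLike.congr_fun hinv ψ.1)
  map_add' x y := Subtype.ext (map_add W x.1 y.1)
  map_smul' c x := Subtype.ext (map_smul W c x.1)
  norm_map' x := W.norm_map x.1

lemma mem_graph_part_iff {A : H →ₗ.[ℂ] H} {K : Submodule ℂ H} {ψ φ : K} :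
    (ψ, φ) ∈ (part A K).graph ↔ ((ψ : H), (φ : H)) ∈ A.graph := by
  constructor
  · intro h
    obtain ⟨x, rfl, rfl⟩ := (LinearPMap.mem_graph_iff _).1 h
    exact (LinearPMap.mem_graph_iff _).2 ⟨⟨x.1, x.2.1⟩, rfl, rfl⟩
  · intro h
    obtain ⟨x, hx, hφ⟩ := (LinearPMap.mem_graph_iff _).1 h
    have hψ : (ψ : H) ∈ A.domain := LinearPMap.mem_domain_of_mem_graph h
    have hx' : x = ⟨ψ, hψ⟩ := Subtype.ext hx
    rw [hx'] at hφ
    exact (LinearPMap.mem_graph_iff _).2 ⟨⟨ψ, hψ, hφ ▸ φ.2⟩, rfl, Subtype.ext hφ⟩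

theorem Integrates.part {U : (Fin d → ℝ) → (H ≃ₗᵢ[ℂ] H)} {X : Fin d → (H →ₗ.[ℂ] H)}
    {D : Submodule ℂ H} (h : Integrates U X D) (K : Submodule ℂ H) [CompleteSpace K]
    (hK : ∀ p, ∀ ψ ∈ K, U p ψ ∈ K) (hdense : Dense (D.comap K.subtype : Set K)) :
    Integrates (fun p => restrictUnitary K (U p) (U (-p)) (hK p) (hK (-p))
        (by rw [← h.map_add, add_neg_cancel, h.map_zero]))
      (fun μ => part (X μ) K) (D.comap K.subtype) := by
  have hclosed : IsClosed (K : Set H) :=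
    (completeSpace_coe_iff_isComplete.1 inferInstance).isClosed
  refine ⟨hdense, ?_, ?_, ?_, ?_, ?_, ?_⟩
  · ext ψ; exact DFunLike.congr_fun h.map_zero ψ.1
  · intro p q; ext ψ; exact DFunLike.congr_fun (h.map_add p q) ψ.1
  · intro ψ _
    exact (h.continuous_apply ψ.1).subtype_mk _
  · intro p ψ hψ
    exact h.mapsTo p ψ.1 hψ
  · intro μ ψ hψ
    obtain ⟨φ, hφ, hg⟩ := h.exists_graph μ ψ.1 hψ
    -- The image of `ψ` is, up to the factor `i`, a limit of difference quotients in the closed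
    -- subspace `K`. This puts `ψ` in the domain of `part`.
    have hφK : Complex.I • φ ∈ K := by
      refine hclosed.mem_of_tendsto (h.generatesAt_single hψ hg) (Eventually.of_forall fun t => ?_)
      exact K.smul_mem _ (K.sub_mem (hK _ _ ψ.2) ψ.2)
    have hφK' : φ ∈ K := (Submodule.smul_mem_iff K Complex.I_ne_zero).1 hφK
    exact ⟨⟨φ, hφK'⟩, hφ, mem_graph_part_iff.2 hg⟩
  · intro p ψ hψ φ hφ
    have h1 := h.generatesAt p ψ.1 hψ (fun μ => (φ μ : H)) fun μ => mem_graph_part_iff.1 (hφ μ)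
    rw [GeneratesAt, tendsto_subtype_rng]
    have e : ((Complex.I • ∑ μ, (p μ : ℂ) • φ μ : K) : H) =
        Complex.I • ∑ μ, (p μ : ℂ) • (φ μ : H) := by
      simp only [Submodule.coe_smul, Submodule.coe_sum]
    rw [e]
    exact h1

end Integrates

/-! ### Direct sums -/

section DirectSum

variable {E : ℕ → Type*} [∀ k, NormedAddCommGroup (E k)] [∀ k, InnerProductSpace ℂ (E k)]

lemma mem_graph_directSumOp {A : ∀ k, E k →ₗ.[ℂ] E k} {ψ φ : lp E 2} :
    (ψ, φ) ∈ (directSumOp A).graph ↔ ∀ k, (ψ k, φ k) ∈ (A k).graph := by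
  constructor
  · intro h k
    obtain ⟨x, rfl, rfl⟩ := (LinearPMap.mem_graph_iff _).1 h
    exact (LinearPMap.mem_graph_iff _).2 ⟨⟨x.1 k, x.2.1 k⟩, rfl, rfl⟩
  · intro h
    have hd : ∀ k, ψ k ∈ (A k).domain := fun k => LinearPMap.mem_domain_of_mem_graph (h k)
    have hv : ∀ k, A k ⟨ψ k, hd k⟩ = φ k := fun k => by
      obtain ⟨x, hx, hφ⟩ := (LinearPMap.mem_graph_iff _).1 (h k)
      exact (congrArg (A k) (Subtype.ext hx.symm)).trans hφ
    have hm : Memℓp (fun k => A k ⟨ψ k, hd k⟩) 2 := by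
      simp only [hv]; exact lp.memℓp φ
    refine (LinearPMap.mem_graph_iff _).2 ⟨⟨ψ, hd, hm⟩, rfl, ?_⟩
    ext k
    exact hv k

lemma single_mem_finiteSum {D : ∀ k, Submodule ℂ (E k)} {k : ℕ} {x : E k} (hx : x ∈ D k) :
    lp.single 2 k x ∈ finiteSum D := by
  refine ⟨fun j => ?_, (Set.finite_singleton k).subset fun j hj => ?_⟩
  · rcases eq_or_ne j k with rfl | hjk
    · rwa [lp.single_apply_self]
    · rw [lp.single_apply_ne _ _ _ hjk]; exact (D j).zero_mem
  · by_contra hjk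
    exact hj (lp.single_apply_ne _ _ _ hjk)

omit [∀ k, InnerProductSpace ℂ (E k)] in
lemma eq_sum_single (ψ : lp E 2) (s : Finset ℕ) (hs : ∀ k, ψ k ≠ 0 → k ∈ s) :
    ψ = ∑ k ∈ s, lp.single 2 k (ψ k) := by
  ext j
  rw [lp.coeFn_sum, Finset.sum_apply]
  by_cases hj : j ∈ s
  · rw [Finset.sum_eq_single_of_mem j hj fun k _ hk => lp.single_apply_ne _ _ _ hk.symm,
      lp.single_apply_self]
  · rw [not_imp_comm.1 (hs j) hj]
    refine (Finset.sum_eq_zero fun k hk => ?_).symm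
    exact lp.single_apply_ne _ _ _ (ne_of_mem_of_not_mem hk hj).symm

/-- If `ψ ∈ K` is orthogonal to `S`, then `ψ k` is orthogonal to `D` and therefore to itself. Only
the single component `ψ k` has to be approximated from `D`, which suits a `K` defined componentwise.
-/
lemma dense_of_single_mem [∀ k, CompleteSpace (E k)] {K : Submodule ℂ (lp E 2)} [CompleteSpace K]
    {S : Submodule ℂ K}
    (hS : ∀ ψ ∈ K, ∀ k, ∃ D : Submodule ℂ (E k), ψ k ∈ closure (D : Set (E k)) ∧
      ∀ x ∈ D, ∃ h : lp.single 2 k x ∈ K, ⟨_, h⟩ ∈ S) : Dense (S : Set K) := by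
  rw [Submodule.dense_iff_topologicalClosure_eq_top, Submodule.topologicalClosure_eq_top_iff,
    Submodule.eq_bot_iff]
  intro ψ hψ
  ext k
  obtain ⟨D, hD, hDS⟩ := hS ψ ψ.2 k
  have h1 : ∀ x ∈ D, ⟪x, ψ.1 k⟫_ℂ = 0 := by
    intro x hx
    obtain ⟨hK, hxS⟩ := hDS x hx
    rw [← lp.inner_single_left]
    exact (Submodule.mem_orthogonal _ _).1 hψ _ hxS
  have h2 : closure (D : Set (E k)) ⊆ {x | ⟪x, ψ.1 k⟫_ℂ = 0} :=
    closure_minimal h1 (isClosed_eq (by fun_prop) continuous_const)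
  exact inner_self_eq_zero.1 (h2 hD)

lemma dense_finiteSum [∀ k, CompleteSpace (E k)] {D : ∀ k, Submodule ℂ (E k)}
    (hD : ∀ k, Dense (D k : Set (E k))) : Dense (finiteSum D : Set (lp E 2)) := by
  rw [Submodule.dense_iff_topologicalClosure_eq_top, Submodule.topologicalClosure_eq_top_iff,
    Submodule.eq_bot_iff]
  intro ψ hψ
  ext k
  refine (hD k).eq_zero_of_inner_right ℂ fun x hx => ?_
  rw [← lp.inner_single_left]
  exact (Submodule.mem_orthogonal _ _).1 hψ _ (single_mem_finiteSum hx)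

/-- Vectors of the domain have finitely many nonzero components, and neither `U` nor `X` creates new
ones. Every limit is thus a finite sum of limits in the summands. -/
theorem Integrates.directSum [∀ k, CompleteSpace (E k)] {d : ℕ}
    {U : ∀ k, (Fin d → ℝ) → (E k ≃ₗᵢ[ℂ] E k)}
    {X : ∀ k, Fin d → (E k →ₗ.[ℂ] E k)} {D : ∀ k, Submodule ℂ (E k)}
    (h : ∀ k, Integrates (U k) (X k) (D k)) :
    Integrates (fun p => directSumUnitary fun k => U k p) (fun μ => directSumOp fun k => X k μ)
      (finiteSum D) := by
  have happ : ∀ p (ψ : lp E 2) k, directSumUnitary (fun k => U k p) ψ k = U k p (ψ k) :=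
    fun _ _ _ => rfl
  refine ⟨dense_finiteSum fun k => (h k).dense, ?_, ?_, ?_, ?_, ?_, ?_⟩
  · ext ψ k; exact DFunLike.congr_fun (h k).map_zero (ψ k)
  · intro p q; ext ψ k; exact DFunLike.congr_fun ((h k).map_add p q) (ψ k)
  · intro ψ hψ
    have h1 : ∀ p, directSumUnitary (fun k => U k p) ψ =
        ∑ k ∈ hψ.2.toFinset, lp.singleContinuousLinearMap ℂ E 2 k (U k p (ψ k)) := by
      intro p
      refine eq_sum_single _ _ fun k hk => ?_
      rw [happ] at hk
      simp only [Set.Finite.mem_toFinset, Set.mem_ofPred_eq]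
      rintro h0
      exact hk (by rw [h0, _root_.map_zero])
    simp only [h1]
    exact continuous_finsetSum _ fun k _ =>
      (lp.singleContinuousLinearMap ℂ E 2 k).continuous.comp ((h k).continuous _ (hψ.1 k))
  · intro p ψ hψ
    refine ⟨fun k => (h k).mapsTo p _ (hψ.1 k), hψ.2.subset fun k hk h0 => hk ?_⟩
    rw [happ, h0, _root_.map_zero]
  · intro μ ψ hψ
    choose φ hφ hg using fun k => (h k).exists_graph μ _ (hψ.1 k)
    have h0 : ∀ k, ψ k = 0 → φ k = 0 := fun k hk =>
      LinearPMap.graph_fst_eq_zero_snd _ (hg k) hk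
    have h1 : ∀ k, (∑ j ∈ hψ.2.toFinset, lp.single 2 j (φ j) : lp E 2) k = φ k := by
      intro k
      rw [lp.coeFn_sum, Finset.sum_apply]
      by_cases hk : k ∈ hψ.2.toFinset
      · rw [Finset.sum_eq_single_of_mem k hk fun j _ hj => lp.single_apply_ne _ _ _ hj.symm,
          lp.single_apply_self]
      · rw [Finset.sum_eq_zero fun j hj =>
          lp.single_apply_ne _ _ _ (ne_of_mem_of_not_mem hj hk).symm]
        simp only [Set.Finite.mem_toFinset, Set.mem_ofPred_eq, not_not] at hk
        exact (h0 k hk).symm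
    refine ⟨∑ j ∈ hψ.2.toFinset, lp.single 2 j (φ j),
      Submodule.sum_mem _ fun j _ => single_mem_finiteSum (hφ j),
      mem_graph_directSumOp.2 fun k => ?_⟩
    rw [h1]; exact hg k
  · intro p ψ hψ φ hφ
    have h0 : ∀ μ k, (ψ k, φ μ k) ∈ (X k μ).graph := fun μ k => mem_graph_directSumOp.1 (hφ μ) k
    have hz : ∀ k, ψ k = 0 → ∀ μ, φ μ k = 0 := fun k hk μ =>
      LinearPMap.graph_fst_eq_zero_snd _ (h0 μ k) hk
    have h1 : ∀ t : ℝ, ((t : ℂ)⁻¹) • (directSumUnitary (fun k => U k (t • p)) ψ - ψ) =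
        ∑ k ∈ hψ.2.toFinset, lp.singleContinuousLinearMap ℂ E 2 k
          (((t : ℂ)⁻¹) • (U k (t • p) (ψ k) - ψ k)) := by
      intro t
      refine eq_sum_single _ _ fun k hk => ?_
      simp only [Set.Finite.mem_toFinset, Set.mem_ofPred_eq]
      rintro h0
      refine hk ?_
      rw [lp.coeFn_smul, Pi.smul_apply, lp.coeFn_sub, Pi.sub_apply, happ, h0]
      simp
    have hval : ∀ k, (Complex.I • ∑ μ, (p μ : ℂ) • φ μ : lp E 2) k =
        Complex.I • ∑ μ, (p μ : ℂ) • φ μ k := by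
      intro k
      rw [lp.coeFn_smul, Pi.smul_apply, lp.coeFn_sum, Finset.sum_apply]
      rfl
    have h2 : Complex.I • ∑ μ, (p μ : ℂ) • φ μ =
        ∑ k ∈ hψ.2.toFinset, lp.singleContinuousLinearMap ℂ E 2 k
          (Complex.I • ∑ μ, (p μ : ℂ) • φ μ k) := by
      refine (eq_sum_single _ hψ.2.toFinset fun k hk => ?_).trans
        (Finset.sum_congr rfl fun k _ => by rw [hval]; rfl)
      simp only [Set.Finite.mem_toFinset, Set.mem_ofPred_eq]
      rintro h0
      refine hk ?_
      rw [hval]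
      simp [hz k h0]
    rw [GeneratesAt, h2]
    simp only [h1]
    exact tendsto_finsetSum _ fun k _ =>
      ((lp.singleContinuousLinearMap ℂ E 2 k).continuous.tendsto _).comp
        ((h k).generatesAt p _ (hψ.1 k) (fun μ => φ μ k) fun μ => h0 μ k)

end DirectSum

/-! ### Multiplication operators -/

section Multiplication

variable {α : Type*} [MeasurableSpace α] {ν : Measure α}

lemma norm_sq_eq_integral (g : Lp ℂ 2 ν) : ‖g‖ ^ 2 = ∫ x, ‖g x‖ ^ 2 ∂ν := by
  have h : ((‖g‖ ^ 2 : ℝ) : ℂ) = ((∫ x, ‖g x‖ ^ 2 ∂ν : ℝ) : ℂ) := by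
    have h1 := inner_self_eq_norm_sq_to_K (𝕜 := ℂ) g
    rw [L2.inner_def] at h1
    simp only [inner_self_eq_norm_sq_to_K] at h1
    rw [← integral_complex_ofReal]
    push_cast
    exact h1.symm
  exact_mod_cast h

/-- Dominated convergence in `L²`. -/
lemma tendsto_zero_of_dominated {ι : Type*} {l : Filter ι} [l.IsCountablyGenerated]
    {g : ι → Lp ℂ 2 ν} {F : ι → α → ℂ} {G : α → ℂ} (hG : MemLp G 2 ν)
    (hg : ∀ i, g i =ᵐ[ν] fun x => F i x * G x) {C : ℝ} (hC : ∀ i x, ‖F i x‖ ≤ C)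
    (hlim : ∀ x, Tendsto (fun i => F i x * G x) l (𝓝 0)) : Tendsto g l (𝓝 0) := by
  have h1 : ∀ i, ‖g i‖ ^ 2 = ∫ x, ‖F i x * G x‖ ^ 2 ∂ν := fun i => by
    rw [norm_sq_eq_integral]
    refine integral_congr_ae ?_
    filter_upwards [hg i] with x hx
    rw [hx]
  have h2 : Tendsto (fun i => ∫ x, ‖F i x * G x‖ ^ 2 ∂ν) l (𝓝 (∫ _, (0 : ℝ) ∂ν)) := by
    refine tendsto_integral_filter_of_dominated_convergence (fun x => C ^ 2 * ‖G x‖ ^ 2)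
      (Eventually.of_forall fun i => ?_) (Eventually.of_forall fun i => ae_of_all _ fun x => ?_)
      ((hG.integrable_norm_pow (by norm_num)).const_mul _) (ae_of_all _ fun x => ?_)
    · exact (((Lp.aestronglyMeasurable (g i)).congr (hg i)).norm).pow 2
    · rw [norm_pow, norm_norm, norm_mul, mul_pow]
      gcongr
      exact hC i x
    · simpa using (hlim x).norm.pow 2
  simp only [← h1, integral_zero] at h2
  rw [tendsto_zero_iff_norm_tendsto_zero]
  simpa using h2.sqrt

lemma memLp_phase {θ : α → ℝ} (hθ : Measurable θ) (f : Lp ℂ 2 ν) :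
    MemLp (fun x => Complex.exp (Complex.I * θ x) * f x) 2 ν := by
  refine (Lp.memLp f).of_le ?_ (ae_of_all _ fun x => ?_)
  · exact (Measurable.aestronglyMeasurable (by fun_prop)).mul (Lp.aestronglyMeasurable f)
  · rw [norm_mul, Complex.norm_exp_I_mul_ofReal, one_mul]

/-- Multiplication by the phase `exp (i θ)` as an operator on `L²`. -/
def phaseFun (θ : α → ℝ) (hθ : Measurable θ) (f : Lp ℂ 2 ν) : Lp ℂ 2 ν :=
  (memLp_phase hθ f).toLp _

lemma coeFn_phaseFun {θ : α → ℝ} (hθ : Measurable θ) (f : Lp ℂ 2 ν) :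
    phaseFun θ hθ f =ᵐ[ν] fun x => Complex.exp (Complex.I * θ x) * f x :=
  MemLp.coeFn_toLp _

/-- The phase `ζ` is a separate variable tied to `θ + η` only pointwise, so differently written
phases can be compared without dependent rewriting. -/
lemma phaseFun_phaseFun {θ η ζ : α → ℝ} (hθ : Measurable θ) (hη : Measurable η)
    (hζ : Measurable ζ) (h : ∀ x, ζ x = θ x + η x) (f : Lp ℂ 2 ν) :
    phaseFun ζ hζ f = phaseFun θ hθ (phaseFun η hη f) := by
  refine Lp.ext ?_
  filter_upwards [coeFn_phaseFun hθ (phaseFun η hη f), coeFn_phaseFun hη f,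
    coeFn_phaseFun hζ f] with x h1 h2 h3
  rw [h1, h2, h3, h, ← mul_assoc, ← Complex.exp_add]
  push_cast
  rw [mul_add]

lemma phaseFun_of_eq_zero {θ : α → ℝ} (hθ : Measurable θ) (h : ∀ x, θ x = 0) (f : Lp ℂ 2 ν) :
    phaseFun θ hθ f = f := by
  refine Lp.ext ?_
  filter_upwards [coeFn_phaseFun hθ f] with x h1
  rw [h1, h]; simp

/-- Multiplication by the phase `exp (i θ)` as a unitary operator on `L²`. -/
def phaseMul (θ : α → ℝ) (hθ : Measurable θ) : Lp ℂ 2 ν ≃ₗᵢ[ℂ] Lp ℂ 2 ν where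
  toFun := phaseFun θ hθ
  invFun := phaseFun (fun x => -θ x) hθ.neg
  left_inv f := by
    rw [← phaseFun_phaseFun _ _ measurable_const (ζ := fun _ => 0) (by simp),
      phaseFun_of_eq_zero _ (by simp)]
  right_inv f := by
    rw [← phaseFun_phaseFun _ _ measurable_const (ζ := fun _ => 0) (by simp),
      phaseFun_of_eq_zero _ (by simp)]
  map_add' f g := by
    refine Lp.ext ?_
    filter_upwards [coeFn_phaseFun hθ (f + g), coeFn_phaseFun hθ f, coeFn_phaseFun hθ g,
      Lp.coeFn_add f g, Lp.coeFn_add (phaseFun θ hθ f) (phaseFun θ hθ g)] with x h1 h2 h3 h4 h5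
    rw [h1, h5, Pi.add_apply, h2, h3, h4, Pi.add_apply, mul_add]
  map_smul' c f := by
    refine Lp.ext ?_
    filter_upwards [coeFn_phaseFun hθ (c • f), coeFn_phaseFun hθ f, Lp.coeFn_smul c f,
      Lp.coeFn_smul c (phaseFun θ hθ f)] with x h1 h2 h3 h4
    rw [RingHom.id_apply, h1, h4, Pi.smul_apply, h2, h3, Pi.smul_apply, smul_eq_mul, smul_eq_mul,
      mul_left_comm]
  norm_map' f := by
    refine (sq_eq_sq₀ (norm_nonneg _) (norm_nonneg _)).1 ?_
    rw [norm_sq_eq_integral, norm_sq_eq_integral]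
    refine integral_congr_ae ?_
    filter_upwards [coeFn_phaseFun hθ f] with x h1
    change ‖phaseFun θ hθ f x‖ ^ 2 = _
    rw [h1, norm_mul, Complex.norm_exp_I_mul_ofReal, one_mul]

lemma coeFn_phaseMul {θ : α → ℝ} (hθ : Measurable θ) (f : Lp ℂ 2 ν) :
    phaseMul θ hθ f =ᵐ[ν] fun x => Complex.exp (Complex.I * θ x) * f x :=
  coeFn_phaseFun hθ f

/-- Dominated convergence with majorant `2 |f|`; it needs a countably generated filter, hence first
countability. -/
lemma continuous_phaseMul {Y : Type*} [TopologicalSpace Y] [FirstCountableTopology Y]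
    {θ : Y → α → ℝ} (hθ : ∀ p, Measurable (θ p)) (hc : ∀ x, Continuous fun p => θ p x)
    (f : Lp ℂ 2 ν) : Continuous fun p => phaseMul (θ p) (hθ p) f := by
  rw [continuous_iff_continuousAt]
  intro q
  rw [ContinuousAt, ← tendsto_sub_nhds_zero_iff]
  refine tendsto_zero_of_dominated (Lp.memLp f) (C := 2)
    (F := fun p x => Complex.exp (Complex.I * θ p x) - Complex.exp (Complex.I * θ q x))
    (fun p => ?_) (fun p x => ?_) (fun x => ?_)
  · filter_upwards [coeFn_phaseMul (hθ p) f, coeFn_phaseMul (hθ q) f,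
      Lp.coeFn_sub (phaseMul (θ p) (hθ p) f) (phaseMul (θ q) (hθ q) f)] with x h1 h2 h3
    rw [h3, Pi.sub_apply, h1, h2, sub_mul]
  · refine (norm_sub_le _ _).trans ?_
    rw [Complex.norm_exp_I_mul_ofReal, Complex.norm_exp_I_mul_ofReal]
    norm_num
  · have h1 : Continuous fun p => (Complex.exp (Complex.I * θ p x) -
        Complex.exp (Complex.I * θ q x)) * f x := by
      have := hc x
      fun_prop
    simpa using h1.tendsto q

lemma mem_graph_mulOp_iff {a : α → ℝ} {f g : Lp ℂ 2 ν} :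
    (f, g) ∈ (mulOp ν a).graph ↔ g =ᵐ[ν] fun x => (a x : ℂ) * f x := by
  constructor
  · intro h
    obtain ⟨x, rfl, rfl⟩ := (LinearPMap.mem_graph_iff _).1 h
    exact MemLp.coeFn_toLp x.2
  · intro h
    have hf : MemLp (fun x => (a x : ℂ) * f x) 2 ν := (Lp.memLp g).ae_eq h
    exact (LinearPMap.mem_graph_iff _).2
      ⟨⟨f, hf⟩, rfl, Lp.ext ((MemLp.coeFn_toLp hf).trans h.symm)⟩

/-- Dominated convergence with majorant `2 |b f|`, square integrable because `b f` is `g`. The bound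
`2` comes from `|e^{is} - 1| ≤ |s|` and `|i| = 1`. -/
lemma generatesAt_phaseMul {b : α → ℝ} {θ : ℝ → α → ℝ} (hθ : ∀ t, Measurable (θ t))
    (hb : ∀ t x, θ t x = t * b x) {f g : Lp ℂ 2 ν} (hg : g =ᵐ[ν] fun x => (b x : ℂ) * f x) :
    GeneratesAt (fun t => phaseMul (ν := ν) (θ t) (hθ t)) f g := by
  rw [GeneratesAt, ← tendsto_sub_nhds_zero_iff]
  have hG : MemLp (fun x => (b x : ℂ) * f x) 2 ν := (Lp.memLp g).ae_eq hg
  -- The quotient is divided by `b x` to extract the factor `b x * f x`. Where `b x = 0` the inverse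
  -- is `0` by convention, and that factor vanishes anyway.
  refine tendsto_zero_of_dominated hG (C := 2)
    (F := fun t x => (t * b x : ℂ)⁻¹ * (Complex.exp (Complex.I * (t * b x : ℝ)) - 1) - Complex.I)
    (fun t => ?_) (fun t x => ?_) (fun x => ?_)
  · filter_upwards [coeFn_phaseMul (hθ t) f, hg, Lp.coeFn_sub (phaseMul (θ t) (hθ t) f) f,
      Lp.coeFn_smul ((t : ℂ)⁻¹) (phaseMul (θ t) (hθ t) f - f), Lp.coeFn_smul Complex.I g,
      Lp.coeFn_sub ((t : ℂ)⁻¹ • (phaseMul (θ t) (hθ t) f - f)) (Complex.I • g)]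
      with x h1 h2 h3 h4 h5 h6
    rw [h6, Pi.sub_apply, h4, h5, Pi.smul_apply, Pi.smul_apply, h3, Pi.sub_apply, h1, h2,
      smul_eq_mul, smul_eq_mul, hb]
    rcases eq_or_ne (b x) 0 with h0 | h0
    · simp [h0]
    · have h0' : (b x : ℂ) ≠ 0 := Complex.ofReal_ne_zero.2 h0
      rw [mul_inv]
      field_simp
  · refine (norm_sub_le _ _).trans ?_
    rw [Complex.norm_I, norm_mul, norm_inv, ← Complex.ofReal_mul, Complex.norm_real]
    have h1 := Real.norm_exp_I_mul_ofReal_sub_one_le (x := t * b x)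
    have h2 : ‖t * b x‖⁻¹ * ‖Complex.exp (Complex.I * (t * b x : ℝ)) - 1‖ ≤ 1 := by
      rw [inv_mul_eq_div]
      exact div_le_one_of_le₀ h1 (norm_nonneg _)
    linarith
  · rcases eq_or_ne (b x) 0 with h0 | h0
    · simp [h0]
    · have h0' : (b x : ℂ) ≠ 0 := Complex.ofReal_ne_zero.2 h0
      have hd : HasDerivAt (fun t : ℝ => Complex.exp (Complex.I * (t * b x : ℝ)))
          (Complex.I * b x) 0 := by
        have h1 : HasDerivAt (fun t : ℝ => Complex.I * ((t * b x : ℝ) : ℂ)) (Complex.I * b x) 0 := by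
          simpa using (((hasDerivAt_id (0 : ℝ)).mul_const (b x)).ofReal_comp).const_mul Complex.I
        simpa using h1.cexp
      have h1 := tendsto_smul_sub_iff_hasDerivAt.2 hd
      have h2 := (h1.sub_const (Complex.I * b x)).mul_const (f x)
      simp only [Complex.ofReal_zero, zero_mul, sub_self] at h2
      refine h2.congr fun t => ?_
      simp only [mul_zero, Complex.exp_zero, smul_eq_mul]
      rw [mul_inv]
      field_simp

lemma measurable_phase {d : ℕ} {a : Fin d → α → ℝ} (ha : ∀ μ, Measurable (a μ)) (p : Fin d → ℝ) :
    Measurable fun x => ∑ μ, p μ * a μ x :=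
  Finset.measurable_fun_sum _ fun μ _ => (ha μ).const_mul _

/-- Commuting multiplication operators are integrated by the multiplication by phases. -/
theorem integrates_phaseMul {d : ℕ} {a : Fin d → α → ℝ} (ha : ∀ μ, Measurable (a μ))
    {D : Submodule ℂ (Lp ℂ 2 ν)} (hD : Dense (D : Set (Lp ℂ 2 ν)))
    (hU : ∀ p, ∀ f ∈ D, phaseMul (fun x => ∑ μ, p μ * a μ x) (measurable_phase ha p) f ∈ D)
    (hA : ∀ μ, ∀ f ∈ D, ∃ g ∈ D, (f, g) ∈ (mulOp ν (a μ)).graph) :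
    Integrates (fun p => phaseMul (fun x => ∑ μ, p μ * a μ x) (measurable_phase ha p))
      (fun μ => mulOp ν (a μ)) D where
  dense := hD
  map_zero := by
    ext1 f
    exact phaseFun_of_eq_zero (measurable_phase ha 0) (by simp) f
  map_add p q := by
    ext1 f
    exact phaseFun_phaseFun (measurable_phase ha p) (measurable_phase ha q)
      (measurable_phase ha (p + q)) (fun x => by
      rw [← Finset.sum_add_distrib]
      exact Finset.sum_congr rfl fun μ _ => add_mul _ _ _) f
  continuous f _ := continuous_phaseMul _ (fun x => by fun_prop) f
  mapsTo := hU
  exists_graph := hA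
  generatesAt p f _ g hg := by
    refine generatesAt_phaseMul (b := fun x => ∑ μ, p μ * a μ x) _ (fun t x => ?_) ?_
    · rw [Finset.mul_sum]
      exact Finset.sum_congr rfl fun μ _ => by simp [mul_assoc]
    · have h1 : ∀ᵐ x ∂ν, ∀ μ, g μ x = (a μ x : ℂ) * f x :=
        ae_all_iff.2 fun μ => mem_graph_mulOp_iff.1 (hg μ)
      have h2 : ∀ᵐ x ∂ν, ∀ μ, ((p μ : ℂ) • g μ) x = (p μ : ℂ) * g μ x :=
        ae_all_iff.2 fun μ => Lp.coeFn_smul _ _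
      filter_upwards [h1, h2, Lp.coeFn_finsetSum (s := Finset.univ) fun μ => (p μ : ℂ) • g μ]
        with x h1 h2 h3
      rw [h3, Finset.sum_apply, Complex.ofReal_sum, Finset.sum_mul]
      refine Finset.sum_congr rfl fun μ _ => ?_
      rw [h2, h1, Complex.ofReal_mul, mul_assoc]

end Multiplication

/-! ### Elementary tensors -/

section Tensors

variable {α : Type*} [MeasurableSpace α] {ν : Measure α} [SigmaFinite ν] {k : ℕ}

lemma coeFn_tensor (f : Fin k → Lp ℂ 2 ν) :
    tensor f =ᵐ[Measure.pi fun _ : Fin k => ν] fun x => ∏ i, f i (x i) :=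
  MemLp.coeFn_toLp _

lemma ae_pi {P : Fin k → α → Prop} (h : ∀ i, ∀ᵐ x ∂ν, P i x) :
    ∀ᵐ x ∂(Measure.pi fun _ : Fin k => ν), ∀ i, P i (x i) :=
  ae_all_iff.2 fun i => (Measure.quasiMeasurePreserving_eval (fun _ : Fin k => ν) i).ae (h i)

lemma norm_tensor (f : Fin k → Lp ℂ 2 ν) : ‖tensor f‖ = ∏ i, ‖f i‖ := by
  refine (sq_eq_sq₀ (norm_nonneg _) (Finset.prod_nonneg fun _ _ => norm_nonneg _)).1 ?_
  have h := inner_tensor f f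
  simp only [inner_self_eq_norm_sq_to_K] at h
  rw [← Finset.prod_pow]
  exact_mod_cast h

variable (ν k) in
/-- The elementary tensor as a multilinear map. -/
def tensorMultilinear : MultilinearMap ℂ (fun _ : Fin k => Lp ℂ 2 ν) (TensorPow ν k) where
  toFun := tensor
  map_update_add' {hdec} f i g g' := by
    -- A `MultilinearMap` allows any decidability instance; it is replaced by the canonical one so
    -- that the `Function.update` terms match.
    obtain rfl : hdec = instDecidableEqFin k := Subsingleton.elim _ _
    refine Lp.ext ?_
    filter_upwards [coeFn_tensor (Function.update f i (g + g')), coeFn_tensor (Function.update f i g),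
      coeFn_tensor (Function.update f i g'),
      Lp.coeFn_add (tensor (Function.update f i g)) (tensor (Function.update f i g')),
      ae_pi (k := k) fun _ => Lp.coeFn_add g g'] with x h1 h2 h3 h4 h5
    rw [h4, Pi.add_apply, h1, h2, h3]
    simp only [← Finset.mul_prod_erase _ _ (Finset.mem_univ i), Function.update_self, h5,
      Pi.add_apply, add_mul]
    have hrest : ∀ e : Lp ℂ 2 ν, ∏ j ∈ Finset.univ.erase i, (Function.update f i e j) (x j) =
        ∏ j ∈ Finset.univ.erase i, f j (x j) := fun e =>
      Finset.prod_congr rfl fun j hj => by rw [Function.update_of_ne (Finset.ne_of_mem_erase hj)]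
    rw [hrest, hrest, hrest]
  map_update_smul' {hdec} f i c g := by
    obtain rfl : hdec = instDecidableEqFin k := Subsingleton.elim _ _
    refine Lp.ext ?_
    filter_upwards [coeFn_tensor (Function.update f i (c • g)), coeFn_tensor (Function.update f i g),
      Lp.coeFn_smul c (tensor (Function.update f i g)),
      ae_pi (k := k) fun _ => Lp.coeFn_smul c g] with x h1 h2 h3 h4
    rw [h3, Pi.smul_apply, h1, h2]
    simp only [← Finset.mul_prod_erase _ _ (Finset.mem_univ i), Function.update_self, h4,
      Pi.smul_apply, smul_eq_mul, mul_assoc]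
    have hrest : ∀ e : Lp ℂ 2 ν, ∏ j ∈ Finset.univ.erase i, (Function.update f i e j) (x j) =
        ∏ j ∈ Finset.univ.erase i, f j (x j) := fun e =>
      Finset.prod_congr rfl fun j hj => by rw [Function.update_of_ne (Finset.ne_of_mem_erase hj)]
    rw [hrest, hrest]

lemma continuous_tensor : Continuous (tensor : (Fin k → Lp ℂ 2 ν) → TensorPow ν k) :=
  ((tensorMultilinear ν k).mkContinuous 1 fun f => by
    rw [one_mul]; exact (norm_tensor f).le).cont

/-- Tensors of vectors from a dense subspace span a dense subspace. -/
lemma dense_span_tensor {D : Submodule ℂ (Lp ℂ 2 ν)} (hD : Dense (D : Set (Lp ℂ 2 ν))) :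
    Dense (Submodule.span ℂ {ψ : TensorPow ν k | ∃ f : Fin k → Lp ℂ 2 ν,
      (∀ i, f i ∈ D) ∧ ψ = tensor f} : Set (TensorPow ν k)) := by
  rw [Submodule.dense_iff_topologicalClosure_eq_top, Submodule.topologicalClosure_eq_top_iff,
    Submodule.eq_bot_iff]
  intro h hh
  refine eq_zero_of_inner_tensor fun f => ?_
  -- Since `tensor` is jointly continuous, orthogonality to tensors of vectors from `D` extends to
  -- all elementary tensors, which are total.
  have h1 : Dense (Set.univ.pi fun _ : Fin k => (D : Set (Lp ℂ 2 ν))) :=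
    dense_pi _ fun _ _ => hD
  refine h1.induction (P := fun f => ⟪tensor f, h⟫_ℂ = 0) (fun g hg => ?_)
    (isClosed_eq (continuous_tensor.inner continuous_const) continuous_const) f
  exact (Submodule.mem_orthogonal _ _).1 hh _
    (Submodule.subset_span ⟨g, fun i => hg i (Set.mem_univ i), rfl⟩)

/-- The exponential of a sum over particles is a product over particles. -/
lemma phaseMul_tensor {θ : α → ℝ} (hθ : Measurable θ) {Θ : (Fin k → α) → ℝ} (hΘ : Measurable Θ)
    (h : ∀ x, Θ x = ∑ j, θ (x j)) (f : Fin k → Lp ℂ 2 ν) :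
    phaseMul Θ hΘ (tensor f) = tensor fun i => phaseMul θ hθ (f i) := by
  refine Lp.ext ?_
  filter_upwards [coeFn_phaseMul hΘ (tensor f), coeFn_tensor f,
    coeFn_tensor fun i => phaseMul θ hθ (f i), ae_pi fun i => coeFn_phaseMul hθ (f i)]
    with x h1 h2 h3 h4
  rw [h1, h2, h3]
  simp only [h4]
  rw [Finset.prod_mul_distrib, h, ← Complex.exp_sum, Complex.ofReal_sum, Finset.mul_sum]

lemma ext_tensor {B C : TensorPow ν k →L[ℂ] TensorPow ν k} (h : ∀ f, B (tensor f) = C (tensor f))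
    (ψ : TensorPow ν k) : B ψ = C ψ := by
  refine denseRange_tensor.induction_on ψ (isClosed_eq (by fun_prop) (by fun_prop)) fun c => ?_
  induction c using Finsupp.induction_linear with
  | zero => simp
  | add c d hc hd => rw [map_add, map_add, map_add, hc, hd]
  | single f a => simp [h]

end Tensors

/-! ### The domain `Δ(P)` -/

section OneParticle

variable {n : ℕ} {m : ℝ}

lemma measurable_energy : Measurable (energy (n := n) m) := by
  unfold energy; fun_prop

lemma measurable_fourMomentum (μ : Fin (n + 1)) :
    Measurable fun p : EuclideanSpace ℝ (Fin n) => fourMomentum m p μ := by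
  refine Fin.cases ?_ (fun j => ?_) μ
  · simpa [fourMomentum] using measurable_energy
  · simp only [fourMomentum, Fin.cons_succ]
    fun_prop

lemma abs_fourMomentum_le (p : EuclideanSpace ℝ (Fin n)) (μ : Fin (n + 1)) :
    |fourMomentum m p μ| ≤ ‖p‖ + |m| := by
  refine Fin.cases ?_ (fun j => ?_) μ
  · simp only [fourMomentum, Fin.cons_zero, energy]
    rw [abs_of_nonneg (Real.sqrt_nonneg _)]
    refine Real.sqrt_le_iff.2 ⟨by positivity, ?_⟩
    nlinarith [norm_nonneg p, abs_nonneg m, sq_abs m, mul_nonneg (norm_nonneg p) (abs_nonneg m)]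
  · simp only [fourMomentum, Fin.cons_succ]
    exact (PiLp.norm_apply_le p j).trans (le_add_of_nonneg_right (abs_nonneg m))

/-- Away from the origin, functions of rapid decay are square integrable on the mass shell. -/
lemma memLp_decay : MemLp (Set.indicator {p : EuclideanSpace ℝ (Fin n) | 1 < ‖p‖}
    fun p => ((1 + ‖p‖ ^ 2) ^ (n + 1))⁻¹) 2 (shellMeasure n m) := by
  have hs : MeasurableSet {p : EuclideanSpace ℝ (Fin n) | 1 < ‖p‖} :=
    measurableSet_lt measurable_const measurable_norm
  have hmeas : Measurable (Set.indicator {p : EuclideanSpace ℝ (Fin n) | 1 < ‖p‖}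
      fun p => ((1 + ‖p‖ ^ 2) ^ (n + 1))⁻¹) := Measurable.indicator (by fun_prop) hs
  have hden : Measurable fun p : EuclideanSpace ℝ (Fin n) =>
      ENNReal.ofReal ((2 * energy m p)⁻¹) := (measurable_energy.const_mul 2).inv.ennreal_ofReal
  rw [memLp_two_iff_integrable_sq_norm hmeas.aestronglyMeasurable, shellMeasure,
    integrable_withDensity_iff_integrable_smul' hden (by simp)]
  -- The square of the function is `(1 + ‖p‖²)^{-2(n+1)}`, and the decay exponent `4(n+1)` exceeds
  -- the dimension `n`.
  have hint : Integrable (fun p : EuclideanSpace ℝ (Fin n) =>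
      (1 + ‖p‖ ^ 2) ^ (-(4 * (n + 1) : ℝ) / 2)) volume :=
    integrable_rpow_neg_one_add_norm_sq (by
      rw [finrank_euclideanSpace, Fintype.card_fin]
      have : (0 : ℝ) ≤ n := Nat.cast_nonneg n
      linarith)
  refine hint.mono' ?_ (ae_of_all _ fun p => ?_)
  · refine Measurable.aestronglyMeasurable ?_
    exact hden.ennreal_toReal.smul (hmeas.norm.pow_const 2)
  · have hpos : (0 : ℝ) < 1 + ‖p‖ ^ 2 := by positivity
    have he : (1 + ‖p‖ ^ 2) ^ (-(4 * (n + 1) : ℝ) / 2) = (((1 + ‖p‖ ^ 2) ^ (n + 1))⁻¹) ^ 2 := by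
      have : (-(4 * (n + 1) : ℝ) / 2) = -(((n + 1) * 2 : ℕ) : ℝ) := by push_cast; ring
      rw [this, Real.rpow_neg hpos.le, Real.rpow_natCast, pow_mul, inv_pow]
    rw [he]
    -- Outside the unit ball the weight `1/(2ω)` is at most `1`. Inside, where it is unbounded if `m
    -- = 0`, the indicator vanishes.
    by_cases hp : 1 < ‖p‖
    · rw [Set.indicator_of_mem (by exact hp), norm_smul, norm_pow, norm_norm]
      have h1 : 1 ≤ energy m p := by
        refine Real.one_le_sqrt.2 ?_
        nlinarith [sq_nonneg m]
      rw [ENNReal.toReal_ofReal (inv_nonneg.2 (by linarith))]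
      have h2 : ‖(2 * energy m p)⁻¹‖ ≤ 1 := by
        rw [norm_inv, Real.norm_of_nonneg (by linarith)]
        exact inv_le_one_of_one_le₀ (by linarith)
      have h3 : ‖((1 + ‖p‖ ^ 2) ^ (n + 1))⁻¹‖ = ((1 + ‖p‖ ^ 2) ^ (n + 1))⁻¹ :=
        Real.norm_of_nonneg (by positivity)
      rw [h3]
      exact mul_le_of_le_one_left (by positivity) h2
    · rw [Set.indicator_of_notMem (by exact hp)]
      simp only [norm_zero, ne_eq, OfNat.ofNat_ne_zero, not_false_eq_true, zero_pow, smul_zero]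
      positivity

lemma mem_deltaP_iff {f : OneParticle n m} : f ∈ deltaP n m ↔
    ∀ r : ℕ, ∃ c : ℝ, ∀ᵐ p ∂(shellMeasure n m), ‖p‖ ^ (2 * r) * ‖f p‖ ≤ c := by
  refine forall_congr' fun r => exists_congr fun c => ?_
  simp [pow_mul]

/-- Multiplication by a function of at most linear growth leaves `Δ(P)` invariant. -/
lemma exists_mem_deltaP_mul {b : EuclideanSpace ℝ (Fin n) → ℝ} (hb : Measurable b)
    (hbound : ∀ p, |b p| ≤ ‖p‖ + |m|) {f : OneParticle n m} (hf : f ∈ deltaP n m) :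
    ∃ g ∈ deltaP n m, (f, g) ∈ (mulOp (shellMeasure n m) b).graph := by
  rw [mem_deltaP_iff] at hf
  have hmul : MemLp (fun p => (b p : ℂ) * f p) 2 (shellMeasure n m) := by
    -- Outside the unit ball, of the available power `‖p‖^{2(n+2)}` one factor `‖p‖²` absorbs `b`,
    -- and the rest absorbs `(1 + ‖p‖²)^{n+1} ≤ (2‖p‖²)^{n+1}`. Inside, `|b| ≤ 1 + |m|` and `f`
    -- itself is the majorant.
    obtain ⟨c, hc⟩ := hf (n + 1 + 1)
    have h1 : MemLp (fun p => (1 + |m|) * ‖f p‖ + (2 ^ (n + 1) * (1 + |m|) * c) *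
        (Set.indicator {p : EuclideanSpace ℝ (Fin n) | 1 < ‖p‖}
          (fun p => ((1 + ‖p‖ ^ 2) ^ (n + 1))⁻¹) p)) 2 (shellMeasure n m) :=
      ((Lp.memLp f).norm.const_mul _).add (memLp_decay.const_mul _)
    refine h1.of_le ?_ ?_
    · exact (Measurable.aestronglyMeasurable (by fun_prop)).mul (Lp.aestronglyMeasurable f)
    filter_upwards [hc] with p hp
    rw [norm_mul, Complex.norm_real, Real.norm_eq_abs]
    refine le_trans ?_ (le_abs_self _)
    by_cases h : 1 < ‖p‖
    · rw [Set.indicator_of_mem (by exact h)]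
      have h2 : |b p| ≤ (1 + |m|) * ‖p‖ ^ 2 := by
        refine (hbound p).trans ?_
        have := abs_nonneg m
        nlinarith [mul_nonneg this (show 0 ≤ ‖p‖ ^ 2 - 1 by nlinarith)]
      have h3 : (1 + ‖p‖ ^ 2) ^ (n + 1) ≤ (2 * ‖p‖ ^ 2) ^ (n + 1) := by
        gcongr
        nlinarith
      have h4 : |b p| * ‖f p‖ * (1 + ‖p‖ ^ 2) ^ (n + 1) ≤ 2 ^ (n + 1) * (1 + |m|) * c := by
        calc |b p| * ‖f p‖ * (1 + ‖p‖ ^ 2) ^ (n + 1)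
            ≤ ((1 + |m|) * ‖p‖ ^ 2) * ‖f p‖ * (2 * ‖p‖ ^ 2) ^ (n + 1) := by gcongr
          _ = 2 ^ (n + 1) * (1 + |m|) * (‖p‖ ^ (2 * (n + 1 + 1)) * ‖f p‖) := by
            rw [mul_pow, ← pow_mul]; ring
          _ ≤ _ := by gcongr
      have h5 := (le_mul_inv_iff₀ (by positivity)).2 h4
      exact h5.trans (le_add_of_nonneg_left (by positivity))
    · rw [Set.indicator_of_notMem (by exact h), mul_zero, add_zero]
      gcongr
      exact (hbound p).trans (by linarith)
  have hae := MemLp.coeFn_toLp hmul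
  refine ⟨hmul.toLp _, mem_deltaP_iff.2 fun r => ?_, mem_graph_mulOp_iff.2 hae⟩
  obtain ⟨c, hc⟩ := hf r
  obtain ⟨c', hc'⟩ := hf (r + 1)
  refine ⟨(1 + |m|) * c + c', ?_⟩
  filter_upwards [hc, hc', hae] with p h1 h2 h3
  rw [h3, norm_mul, Complex.norm_real, Real.norm_eq_abs]
  -- Decay of order `r` for `b f` thus follows from orders `r` and `r + 1` for `f`.
  have h4 : |b p| ≤ (1 + |m|) + ‖p‖ ^ 2 :=
    (hbound p).trans (by nlinarith [sq_nonneg (‖p‖ - 1)])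
  calc ‖p‖ ^ (2 * r) * (|b p| * ‖f p‖)
      ≤ ‖p‖ ^ (2 * r) * (((1 + |m|) + ‖p‖ ^ 2) * ‖f p‖) := by gcongr
    _ = (1 + |m|) * (‖p‖ ^ (2 * r) * ‖f p‖) + ‖p‖ ^ (2 * (r + 1)) * ‖f p‖ := by ring
    _ ≤ _ := by gcongr

lemma phaseMul_mem_deltaP {θ : EuclideanSpace ℝ (Fin n) → ℝ} (hθ : Measurable θ)
    {f : OneParticle n m} (hf : f ∈ deltaP n m) : phaseMul θ hθ f ∈ deltaP n m := by
  rw [mem_deltaP_iff] at hf ⊢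
  intro r
  obtain ⟨c, hc⟩ := hf r
  refine ⟨c, ?_⟩
  filter_upwards [hc, coeFn_phaseMul hθ f] with p h1 h2
  rwa [h2, norm_mul, Complex.norm_exp_I_mul_ofReal, one_mul]

/-- If `h` is orthogonal to `Δ(P)`, its truncation to `‖p‖ ≤ N`, `‖h p‖ ≤ N` lies in `Δ(P)`, and the
inner product of the truncation with `h` is its own squared norm. So `h` vanishes almost everywhere
on these sets, which exhaust the space. -/
lemma dense_deltaP : Dense (deltaP n m : Set (OneParticle n m)) := by
  rw [Submodule.dense_iff_topologicalClosure_eq_top, Submodule.topologicalClosure_eq_top_iff,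
    Submodule.eq_bot_iff]
  intro h hh
  have key : ∀ N : ℕ, ∀ᵐ p ∂(shellMeasure n m), ‖p‖ ≤ N → ‖h p‖ ≤ N → h p = 0 := by
    intro N
    set s : Set (EuclideanSpace ℝ (Fin n)) := {p | ‖p‖ ≤ N ∧ ‖h p‖ ≤ N} with hs
    have hsm : MeasurableSet s :=
      (measurableSet_le measurable_norm measurable_const).inter
        (measurableSet_le (Lp.stronglyMeasurable h).measurable.norm measurable_const)
    have hm := (Lp.memLp h).indicator hsm
    have hae := MemLp.coeFn_toLp hm
    have hD : hm.toLp _ ∈ deltaP n m := by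
      refine mem_deltaP_iff.2 fun r => ⟨(N : ℝ) ^ (2 * r) * N, ?_⟩
      filter_upwards [hae] with p hp
      rw [hp]
      by_cases hps : p ∈ s
      · rw [Set.indicator_of_mem hps]
        gcongr
        exacts [hps.1, hps.2]
      · rw [Set.indicator_of_notMem hps, norm_zero, mul_zero]
        positivity
    have h0 : ⟪hm.toLp _, hm.toLp _⟫_ℂ = 0 := by
      rw [← (Submodule.mem_orthogonal _ _).1 hh _ hD, L2.inner_def, L2.inner_def]
      refine integral_congr_ae ?_
      filter_upwards [hae] with p hp
      rw [hp]
      by_cases hps : p ∈ s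
      · rw [Set.indicator_of_mem hps]
      · rw [Set.indicator_of_notMem hps, inner_zero_left, inner_zero_left]
    rw [inner_self_eq_zero] at h0
    rw [h0] at hae
    filter_upwards [hae, Lp.coeFn_zero ℂ 2 (shellMeasure n m)] with p h1 h2 h3 h4
    rw [h2, Set.indicator_of_mem (show p ∈ s from ⟨h3, h4⟩)] at h1
    exact h1.symm
  refine Lp.ext ?_
  filter_upwards [ae_all_iff.2 key, Lp.coeFn_zero ℂ 2 (shellMeasure n m)] with p h1 h2
  rw [h2]
  obtain ⟨N, hN⟩ := exists_nat_ge (max ‖p‖ ‖h p‖)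
  exact h1 N ((le_max_left _ _).trans hN) ((le_max_right _ _).trans hN)

end OneParticle

/-! ### The `k`-particle space -/

section KParticle

variable (n : ℕ) (m : ℝ) (k : ℕ)

lemma measurable_totalMomentum (μ : Fin (n + 1)) :
    Measurable fun x : Fin k → EuclideanSpace ℝ (Fin n) => ∑ j, fourMomentum m (x j) μ :=
  Finset.measurable_fun_sum _ fun j _ => (measurable_fourMomentum μ).comp (measurable_pi_apply j)

/-- The translation `exp (i p · P)` on the `k`-particle space. -/
def translationK (p : Fin (n + 1) → ℝ) : KParticle n m k ≃ₗᵢ[ℂ] KParticle n m k :=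
  phaseMul _ (measurable_phase (measurable_totalMomentum n m k) p)

lemma translationK_tensor (p : Fin (n + 1) → ℝ) (f : Fin k → OneParticle n m) :
    translationK n m k p (tensor f) =
      tensor fun i => phaseMul _ (measurable_phase (measurable_fourMomentum (m := m)) p) (f i) :=
  phaseMul_tensor _ _ (fun x => by
    rw [Finset.sum_comm]
    exact Finset.sum_congr rfl fun μ _ => Finset.mul_sum _ _ _) f

variable {n m k} in
lemma tensor_mem_deltaKP {f : Fin k → OneParticle n m} (hf : ∀ i, f i ∈ deltaP n m) :
    tensor f ∈ deltaKP n m k :=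
  Submodule.subset_span ⟨f, hf, rfl⟩

theorem integrates_momentumK :
    Integrates (translationK n m k) (momentumK n m k) (deltaKP n m k) := by
  refine integrates_phaseMul (measurable_totalMomentum n m k) (dense_span_tensor dense_deltaP)
    (fun p ψ hψ => ?_) fun μ ψ hψ => ?_
  · change translationK n m k p ψ ∈ _
    induction hψ using Submodule.span_induction with
    | mem ψ hψ =>
      obtain ⟨f, hf, rfl⟩ := hψ
      rw [translationK_tensor]
      exact tensor_mem_deltaKP fun i => phaseMul_mem_deltaP _ (hf i)
    | zero => rw [map_zero]; exact Submodule.zero_mem _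
    | add x y _ _ hx hy => rw [map_add]; exact Submodule.add_mem _ hx hy
    | smul c x _ hx => rw [map_smul]; exact Submodule.smul_mem _ c hx
  · induction hψ using Submodule.span_induction with
    | mem ψ hψ =>
      obtain ⟨f, hf, rfl⟩ := hψ
      choose g hg hgraph using fun i =>
        exists_mem_deltaP_mul (measurable_fourMomentum μ) (fun p => abs_fourMomentum_le p μ) (hf i)
      have hdom := fun i => LinearPMap.mem_domain_of_mem_graph (hgraph i)
      have hval : ∀ i, mulOp (shellMeasure n m) (fun p => fourMomentum m p μ) ⟨f i, hdom i⟩ = g i :=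
        fun i => LinearPMap.mem_graph_snd_inj _ (LinearPMap.mem_graph _ ⟨f i, hdom i⟩) (hgraph i) rfl
      -- The witness is the Leibniz sum from `mulOp_sum_tensor`: each term replaces one factor `f j`
      -- by `p^μ f j`, which is again in `Δ(P)`.
      refine ⟨_, Submodule.sum_mem _ fun j _ => tensor_mem_deltaKP fun i => ?_,
        mulOp_sum_tensor (fun p => fourMomentum m p μ) fun i => ⟨f i, hdom i⟩⟩
      rw [hval]
      rcases eq_or_ne i j with rfl | hij
      · rw [Function.update_self]; exact hg i
      · rw [Function.update_of_ne hij]; exact hf i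
    | zero => exact ⟨0, Submodule.zero_mem _, Submodule.zero_mem _⟩
    | add x y _ _ hx hy =>
      obtain ⟨x', hx', hgx⟩ := hx
      obtain ⟨y', hy', hgy⟩ := hy
      exact ⟨x' + y', Submodule.add_mem _ hx' hy', Submodule.add_mem _ hgx hgy⟩
    | smul c x _ hx =>
      obtain ⟨x', hx', hgx⟩ := hx
      exact ⟨c • x', Submodule.smul_mem _ c hx', Submodule.smul_mem _ c hgx⟩

end KParticle

/-! ### Symmetrization -/

section Symmetrization

variable {α : Type*} [MeasurableSpace α] {ν : Measure α} [SigmaFinite ν] {k : ℕ}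

variable (ν) in
/-- The action of a permutation on the `k`-particle space. -/
def permOp (σ : Equiv.Perm (Fin k)) : TensorPow ν k →ₗᵢ[ℂ] TensorPow ν k :=
  Lp.compMeasurePreservingₗᵢ ℂ (E := ℂ) (p := 2) _ (measurePreserving_perm (ν := ν) σ)

lemma coeFn_permOp (σ : Equiv.Perm (Fin k)) (ψ : TensorPow ν k) :
    permOp ν σ ψ =ᵐ[Measure.pi fun _ : Fin k => ν] fun x => ψ (x ∘ σ) :=
  Lp.coeFn_compMeasurePreserving ψ (measurePreserving_perm (ν := ν) σ)

lemma mem_symmetricSubspace_iff {ψ : TensorPow ν k} :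
    ψ ∈ symmetricSubspace ν k ↔ ∀ σ, permOp ν σ ψ = ψ := by
  simp only [symmetricSubspace, Submodule.mem_iInf, LinearMap.mem_ker, LinearMap.sub_apply,
    sub_eq_zero]
  rfl

/-- Composing coordinates with `σ` moves the factors by `σ⁻¹`, which makes `permOp` a left action
(`permOp_permOp`). -/
lemma permOp_tensor (σ : Equiv.Perm (Fin k)) (f : Fin k → Lp ℂ 2 ν) :
    permOp ν σ (tensor f) = tensor fun i => f (σ.symm i) := by
  refine Lp.ext ?_
  filter_upwards [coeFn_permOp σ (tensor f), coeFn_tensor fun i => f (σ.symm i),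
    (measurePreserving_perm (ν := ν) σ).quasiMeasurePreserving.ae (coeFn_tensor f)] with x h1 h2 h3
  rw [h1, h2, h3]
  exact Fintype.prod_equiv σ _ _ fun i => by simp

lemma permOp_permOp (σ τ : Equiv.Perm (Fin k)) (ψ : TensorPow ν k) :
    permOp ν σ (permOp ν τ ψ) = permOp ν (σ * τ) ψ := by
  refine ext_tensor (B := (permOp ν σ).toContinuousLinearMap ∘L (permOp ν τ).toContinuousLinearMap)
    (C := (permOp ν (σ * τ)).toContinuousLinearMap) (fun f => ?_) ψ
  change permOp ν σ (permOp ν τ (tensor f)) = permOp ν (σ * τ) (tensor f)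
  rw [permOp_tensor, permOp_tensor, permOp_tensor]
  rfl

/-- An operator which acts on elementary tensors factor by factor commutes with permutations. -/
lemma permOp_comm {B : TensorPow ν k ≃ₗᵢ[ℂ] TensorPow ν k} {b : Lp ℂ 2 ν → Lp ℂ 2 ν}
    (hB : ∀ f, B (tensor f) = tensor fun i => b (f i)) (σ : Equiv.Perm (Fin k))
    (ψ : TensorPow ν k) : permOp ν σ (B ψ) = B (permOp ν σ ψ) := by
  refine ext_tensor
    (B := (permOp ν σ).toContinuousLinearMap ∘L B.toContinuousLinearEquiv.toContinuousLinearMap)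
    (C := B.toContinuousLinearEquiv.toContinuousLinearMap ∘L (permOp ν σ).toContinuousLinearMap)
    (fun f => ?_) ψ
  change permOp ν σ (B (tensor f)) = B (permOp ν σ (tensor f))
  rw [hB, permOp_tensor, permOp_tensor, hB]

lemma apply_mem_symmetricSubspace {B : TensorPow ν k ≃ₗᵢ[ℂ] TensorPow ν k}
    {b : Lp ℂ 2 ν → Lp ℂ 2 ν} (hB : ∀ f, B (tensor f) = tensor fun i => b (f i))
    {ψ : TensorPow ν k} (hψ : ψ ∈ symmetricSubspace ν k) : B ψ ∈ symmetricSubspace ν k := by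
  rw [mem_symmetricSubspace_iff] at hψ ⊢
  intro σ
  rw [permOp_comm hB, hψ]

variable (ν k) in
/-- The symmetrization operator. -/
def symmetrization : TensorPow ν k →L[ℂ] TensorPow ν k :=
  ((Fintype.card (Equiv.Perm (Fin k)) : ℂ)⁻¹) •
    ∑ σ : Equiv.Perm (Fin k), (permOp ν σ).toContinuousLinearMap

lemma symmetrization_apply (ψ : TensorPow ν k) :
    symmetrization ν k ψ = ((Fintype.card (Equiv.Perm (Fin k)) : ℂ)⁻¹) •
      ∑ σ : Equiv.Perm (Fin k), permOp ν σ ψ := by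
  simp [symmetrization]

lemma symmetrization_mem (ψ : TensorPow ν k) :
    symmetrization ν k ψ ∈ symmetricSubspace ν k := by
  rw [mem_symmetricSubspace_iff]
  intro σ
  rw [symmetrization_apply, map_smul, map_sum]
  simp only [permOp_permOp]
  congr 1
  exact Fintype.sum_equiv (Equiv.mulLeft σ) _ _ fun τ => rfl

lemma symmetrization_of_mem {ψ : TensorPow ν k} (hψ : ψ ∈ symmetricSubspace ν k) :
    symmetrization ν k ψ = ψ := by
  rw [mem_symmetricSubspace_iff] at hψ
  rw [symmetrization_apply, Finset.sum_congr rfl fun σ _ => hψ σ, Finset.sum_const,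
    Finset.card_univ, ← Nat.cast_smul_eq_nsmul ℂ, smul_smul, inv_mul_cancel₀, one_smul]
  exact Nat.cast_ne_zero.2 Fintype.card_ne_zero

/-- A dense subspace invariant under permutations is dense in the symmetric subspace. -/
lemma dense_comap_symmetricSubspace {D : Submodule ℂ (TensorPow ν k)}
    (hD : Dense (D : Set (TensorPow ν k))) (hσ : ∀ σ, ∀ ψ ∈ D, permOp ν σ ψ ∈ D) :
    Dense (D.comap (symmetricSubspace ν k).subtype : Set (symmetricSubspace ν k)) := by
  -- Symmetrization is continuous, maps onto the symmetric subspace and preserves `D`, so it carries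
  -- the dense `D` to a dense set of symmetric vectors in `D`.
  let S : TensorPow ν k → symmetricSubspace ν k := fun ψ =>
    ⟨symmetrization ν k ψ, symmetrization_mem ψ⟩
  have hS : Continuous S := (symmetrization ν k).continuous.subtype_mk _
  have hsurj : Function.Surjective S := fun ψ => ⟨ψ, Subtype.ext (symmetrization_of_mem ψ.2)⟩
  refine (hsurj.denseRange.dense_image hS hD).mono ?_
  rintro _ ⟨ψ, hψ, rfl⟩
  change symmetrization ν k ψ ∈ D
  rw [symmetrization_apply]
  exact D.smul_mem _ (D.sum_mem fun σ _ => hσ σ ψ hψ)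

end Symmetrization

/-! ### The operators `X` -/

section OperatorsX

variable {n : ℕ} {m : ℝ} (V : OneParticle n m ≃ₗᵢ[ℂ] OneParticle n m)

/-- The representation `exp (i p · X)` on the `k`-particle space. -/
def expK (k : ℕ) (p : Fin (n + 1) → ℝ) : KParticle n m k ≃ₗᵢ[ℂ] KParticle n m k :=
  tensorPow V.symm k * translationK n m k p * tensorPow V k

/-- The representation `exp (i p · X)` on Fock space. -/
def expFock (p : Fin (n + 1) → ℝ) : Fock n m ≃ₗᵢ[ℂ] Fock n m :=
  Gam V.symm * (directSumUnitary fun k => translationK n m k p) * Gam V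

theorem integrates_opXK (k : ℕ) : Integrates (expK V k) (opXK V k) (deltaKX V k) :=
  (integrates_momentumK n m k).sandwich (tensorPow V.symm k) (tensorPow V k) (by ext1 ψ; rfl)

theorem integrates_opX : Integrates (expFock V) (opX V) (deltaFockX V) :=
  (Integrates.directSum fun k => integrates_momentumK n m k).sandwich (Gam V.symm) (Gam V)
    (by ext1 ψ; rfl)

/-- The action factor by factor is what makes `expK` commute with permutations and so preserve the
bosonic subspace. -/
lemma expK_tensor (k : ℕ) (p : Fin (n + 1) → ℝ) (f : Fin k → OneParticle n m) :
    expK V k p (tensor f) = tensor fun i => V.symm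
      (phaseMul _ (measurable_phase (measurable_fourMomentum (m := m)) p) (V (f i))) := by
  change tensorPow V.symm k (translationK n m k p (tensorPow V k (tensor f))) = _
  rw [tensorPow_tensor, translationK_tensor, tensorPow_tensor]

lemma permOp_mem_deltaKP {k : ℕ} (σ : Equiv.Perm (Fin k)) {ψ : KParticle n m k}
    (hψ : ψ ∈ deltaKP n m k) : permOp (shellMeasure n m) σ ψ ∈ deltaKP n m k := by
  induction hψ using Submodule.span_induction with
  | mem ψ hψ =>
    obtain ⟨f, hf, rfl⟩ := hψ
    rw [permOp_tensor]
    exact tensor_mem_deltaKP fun i => hf _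
  | zero => rw [map_zero]; exact Submodule.zero_mem _
  | add x y _ _ hx hy => rw [map_add]; exact Submodule.add_mem _ hx hy
  | smul c x _ hx => rw [map_smul]; exact Submodule.smul_mem _ c hx

lemma permOp_mem_deltaKX {k : ℕ} (σ : Equiv.Perm (Fin k)) {ψ : KParticle n m k}
    (hψ : ψ ∈ deltaKX V k) : permOp (shellMeasure n m) σ ψ ∈ deltaKX V k := by
  obtain ⟨χ, hχ, rfl⟩ := hψ
  exact ⟨_, permOp_mem_deltaKP σ hχ, (permOp_comm (tensorPow_tensor V.symm) σ χ).symm⟩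

lemma dense_comap_deltaKX (k : ℕ) :
    Dense ((deltaKX V k).comap (symmetricSubspace (shellMeasure n m) k).subtype :
      Set (symmetricSubspace (shellMeasure n m) k)) :=
  dense_comap_symmetricSubspace (integrates_opXK V k).dense fun σ _ => permOp_mem_deltaKX V σ

lemma expK_mem_symmetricSubspace {k : ℕ} (p : Fin (n + 1) → ℝ) {ψ : KParticle n m k}
    (hψ : ψ ∈ symmetricSubspace (shellMeasure n m) k) :
    expK V k p ψ ∈ symmetricSubspace (shellMeasure n m) k :=
  apply_mem_symmetricSubspace (b := fun f => V.symm
    (phaseMul _ (measurable_phase (measurable_fourMomentum (m := m)) p) (V f))) (expK_tensor V k p) hψ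

lemma mem_bosonicFock_iff {ψ : Fock n m} :
    ψ ∈ bosonicFock n m ↔ ∀ k, ψ k ∈ symmetricSubspace (shellMeasure n m) k := by
  simp only [bosonicFock, componentwise, Submodule.mem_iInf]
  rfl

lemma expFock_mem_bosonicFock (p : Fin (n + 1) → ℝ) {ψ : Fock n m} (hψ : ψ ∈ bosonicFock n m) :
    expFock V p ψ ∈ bosonicFock n m := by
  rw [mem_bosonicFock_iff] at hψ ⊢
  -- The `k`-th component of `expFock V p ψ` is `expK V k p (ψ k)` by definition.
  exact fun k => expK_mem_symmetricSubspace V p (hψ k)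

lemma single_mem_deltaFockX {k : ℕ} {x : KParticle n m k} (hx : x ∈ deltaKX V k) :
    (lp.single 2 k x : Fock n m) ∈ deltaFockX V := by
  obtain ⟨y, hy, rfl⟩ := hx
  refine ⟨lp.single 2 k y, single_mem_finiteSum hy, ?_⟩
  ext1
  funext j
  change tensorPow V.symm j ((lp.single 2 k y : Fock n m) j) = _
  rcases eq_or_ne j k with rfl | hjk
  · rw [lp.single_apply_self, lp.single_apply_self]; rfl
  · rw [lp.single_apply_ne _ _ _ hjk, lp.single_apply_ne _ _ _ hjk, map_zero]

/-- Reduces to density on each bosonic `k`-particle space, since vectors with a single nonzero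
component, symmetric and in `Δ_k(X)`, belong to the domain. -/
lemma dense_comap_deltaFockX :
    Dense ((deltaFockX V).comap (bosonicFock n m).subtype : Set (bosonicFock n m)) := by
  refine dense_of_single_mem fun ψ hψ k =>
    ⟨deltaKX V k ⊓ symmetricSubspace (shellMeasure n m) k, ?_, fun x hx => ⟨?_, ?_⟩⟩
  · have h1 := dense_comap_deltaKX V k ⟨ψ k, mem_bosonicFock_iff.1 hψ k⟩
    refine closure_mono ?_ (image_closure_subset_closure_image continuous_subtype_val
      ⟨_, h1, rfl⟩)
    rintro _ ⟨χ, hχ, rfl⟩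
    exact ⟨hχ, χ.2⟩
  · refine mem_bosonicFock_iff.2 fun j => ?_
    rcases eq_or_ne j k with rfl | hjk
    · rw [lp.single_apply_self]; exact hx.2
    · rw [lp.single_apply_ne _ _ _ hjk]; exact Submodule.zero_mem _
  · exact single_mem_deltaFockX V hx.1

end OperatorsX

end WarpedQFT

end

theorem mainTheorem9 (n : ℕ) (hn : 1 ≤ n) (m : ℝ) (hm : 0 ≤ m)
    (V : OneParticle n m ≃ₗᵢ[ℂ] OneParticle n m) :
    -- on each `k`-particle space, with the domain `Δ_k(X)`
    (∀ k : ℕ, IsCommutingEssSelfAdjoint (opXK V k) (deltaKX V k) ∧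
      GeneratesUnitaryGroup (opXK V k) (deltaKX V k)) ∧
    -- on Fock space, with the finite sums of vectors from the `Δ_k(X)`
    (IsCommutingEssSelfAdjoint (opX V) (deltaFockX V) ∧
      GeneratesUnitaryGroup (opX V) (deltaFockX V)) ∧
    -- on the bosonic `k`-particle spaces
    (∀ k : ℕ,
      IsCommutingEssSelfAdjoint
        (fun μ => part (opXK V k μ) (symmetricSubspace (shellMeasure n m) k))
        ((deltaKX V k).comap (symmetricSubspace (shellMeasure n m) k).subtype) ∧
      GeneratesUnitaryGroup
        (fun μ => part (opXK V k μ) (symmetricSubspace (shellMeasure n m) k))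
        ((deltaKX V k).comap (symmetricSubspace (shellMeasure n m) k).subtype)) ∧
    -- on bosonic Fock space
    (IsCommutingEssSelfAdjoint
        (fun μ => part (opX V μ) (bosonicFock n m))
        ((deltaFockX V).comap (bosonicFock n m).subtype) ∧
      GeneratesUnitaryGroup
        (fun μ => part (opX V μ) (bosonicFock n m))
        ((deltaFockX V).comap (bosonicFock n m).subtype)) := by
  refine ⟨fun k => ?_, ?_, fun k => ?_, ?_⟩
  · exact ⟨(integrates_opXK V k).isCommutingEssSelfAdjoint,
      (integrates_opXK V k).generatesUnitaryGroup⟩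
  · exact ⟨(integrates_opX V).isCommutingEssSelfAdjoint, (integrates_opX V).generatesUnitaryGroup⟩
  · have h := (integrates_opXK V k).part (symmetricSubspace (shellMeasure n m) k)
      (fun p ψ => expK_mem_symmetricSubspace V p) (dense_comap_deltaKX V k)
    exact ⟨h.isCommutingEssSelfAdjoint, h.generatesUnitaryGroup⟩
  · have h := (integrates_opX V).part (bosonicFock n m)
      (fun p ψ => expFock_mem_bosonicFock V p) (dense_comap_deltaFockX V)
    exact ⟨h.isCommutingEssSelfAdjoint, h.generatesUnitaryGroup⟩
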